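/- The running time below is that of a random access machine under the logarithmic cost criterion: an operation is charged for the bit lengths of the numbers and addresses that it handles (a multiplication or division for the product of the bit lengths of its operands). A set $D$ of vertices of a graph is dominating if every vertex not in $D$ has a neighbour in $D$. A graph admits a packing with $k$ dominating sets if there are $k$ pairwise disjoint dominating sets $S_1,\dots,S_k$. The domatic number is the largest $k$ for which the vertex set can be partitioned into $k$ dominating sets. Theorem. (1) There are an algorithm and constants $C,c$ such that, for every $n$, every $\Delta\ge 1$, every $n$-vertex graph $G$ of maximum degree $\Delta$ and every $k\ge 0$, the algorithm, given the adjacency matrix of $G$ and the number $k$ (in unary), decides within time $$C\,n^{c}\,\bigl(2^{\Delta+1}-2\bigr)^{n/(\Delta+1)}$$ whether $G$ admits a packing with $k$ dominating sets. (2) There are an algorithm and constants $C,c$ such that, for every $n$, every $\Delta\ge 1$ and every $n$-vertex graph $G$ of maximum degree $\Delta$, the algorithm, given the adjacency matrix of $G$, computes the domatic number of $G$ within time $C\,n^{c}\,(2^{\Delta+1}-2)^{n/(\Delta+1)}$. In both parts the algorithm and the constants $C,c$ do not depend on $n$, $\Delta$, $k$ or $G$. -/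

import Mathlib

/-! Dominating sets, packings, domatic partitions. -/

/-- `D` is dominating: every vertex not in `D` has at least one neighbour in `D`. -/
def IsDominating {V : Type*} (G : SimpleGraph V) (D : Set V) : Prop :=
  ∀ v, v ∉ D → ∃ u ∈ D, G.Adj v u

/-- `G` admits a packing with `k` dominating sets: a `k`-tuple of pairwise disjoint dominating
sets. -/
def HasDominatingPacking {V : Type*} (G : SimpleGraph V) (k : ℕ) : Prop :=
  ∃ S : Fin k → Set V, (∀ i, IsDominating G (S i)) ∧ ∀ i j, i ≠ j → Disjoint (S i) (S j)

/-- The vertex set of `G` can be partitioned into `k` dominating sets. -/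
def HasDomaticPartition {V : Type*} (G : SimpleGraph V) (k : ℕ) : Prop :=
  ∃ S : Fin k → Set V, (∀ i, IsDominating G (S i)) ∧ (∀ i j, i ≠ j → Disjoint (S i) (S j)) ∧
    (⋃ i, S i) = Set.univ

/-- `d` is the domatic number of `G`: the largest `k` for which the vertex set can be partitioned
into `k` dominating sets. -/
def IsDomaticNumber {V : Type*} (G : SimpleGraph V) (d : ℕ) : Prop :=
  IsGreatest {k : ℕ | HasDomaticPartition G k} d

/-! A random access machine with the logarithmic cost criterion, programmed by structured
programs. The input is a read-only finite sequence of natural numbers (with random access, `0`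
beyond its end). The working memory is a sequence of registers, addressed by natural numbers, each
holding a natural number; all of them are `0` initially. Every operation is charged for the bit
lengths `Nat.size` of the numbers it handles, addresses included; a multiplication or division is
charged for the product of the bit lengths of its operands. -/

namespace RAM

/-- Expressions of the machine. -/
inductive RExp : Type
  /-- a constant -/
  | lit : ℕ → RExp
  /-- the input entry at a computed position -/
  | inp : RExp → RExp
  /-- the content of the register at a computed address -/
  | mem : RExp → RExp
  /-- addition -/
  | add : RExp → RExp → RExp
  /-- truncated subtraction -/
  | sub : RExp → RExp → RExp
  /-- multiplication -/
  | mul : RExp → RExp → RExp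
  /-- integer division (rounded down; division by `0` gives `0`) -/
  | div : RExp → RExp → RExp

/-- The value of an expression on input `x` and memory `m`. -/
def RExp.eval (x : List ℕ) (m : ℕ → ℕ) : RExp → ℕ
  | .lit c => c
  | .inp a => x.getD (a.eval x m) 0
  | .mem a => m (a.eval x m)
  | .add a b => a.eval x m + b.eval x m
  | .sub a b => a.eval x m - b.eval x m
  | .mul a b => a.eval x m * b.eval x m
  | .div a b => a.eval x m / b.eval x m

/-- The time it takes to evaluate an expression on input `x` and memory `m`. -/
def RExp.cost (x : List ℕ) (m : ℕ → ℕ) : RExp → ℕ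
  | .lit c => 1 + c.size
  | .inp a => a.cost x m + (1 + (a.eval x m).size + (x.getD (a.eval x m) 0).size)
  | .mem a => a.cost x m + (1 + (a.eval x m).size + (m (a.eval x m)).size)
  | .add a b => a.cost x m + b.cost x m + (1 + (a.eval x m).size + (b.eval x m).size)
  | .sub a b => a.cost x m + b.cost x m + (1 + (a.eval x m).size + (b.eval x m).size)
  | .mul a b => a.cost x m + b.cost x m + (1 + (a.eval x m).size) * (1 + (b.eval x m).size)
  | .div a b => a.cost x m + b.cost x m + (1 + (a.eval x m).size) * (1 + (b.eval x m).size)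

/-- Programs of the machine. -/
inductive RProg : Type
  /-- do nothing -/
  | skip : RProg
  /-- `store a e` writes the value of `e` to the register whose address is the value of `a` -/
  | store : RExp → RExp → RProg
  /-- sequential composition -/
  | seq : RProg → RProg → RProg
  /-- `cond e p q` runs `p` if the value of `e` is nonzero, and `q` otherwise -/
  | cond : RExp → RProg → RProg → RProg
  /-- `loop e p` repeats `p` as long as the value of `e` is nonzero -/
  | loop : RExp → RProg → RProg

/-- `Runs x p m t m'`: on input `x`, the program `p`, started with memory `m`, halts after time
exactly `t` with memory `m'`. -/
inductive Runs (x : List ℕ) : RProg → (ℕ → ℕ) → ℕ → (ℕ → ℕ) → Prop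
  | skip (m : ℕ → ℕ) : Runs x .skip m 1 m
  | store (a e : RExp) (m : ℕ → ℕ) :
      Runs x (.store a e) m
        (a.cost x m + e.cost x m + (1 + (a.eval x m).size + (e.eval x m).size))
        (Function.update m (a.eval x m) (e.eval x m))
  | seq {p q : RProg} {m m' m'' : ℕ → ℕ} {t t' : ℕ} :
      Runs x p m t m' → Runs x q m' t' m'' → Runs x (.seq p q) m (t + t') m''
  | cond_true {e : RExp} {p q : RProg} {m m' : ℕ → ℕ} {t : ℕ} :
      e.eval x m ≠ 0 → Runs x p m t m' → Runs x (.cond e p q) m (e.cost x m + 1 + t) m'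
  | cond_false {e : RExp} {p q : RProg} {m m' : ℕ → ℕ} {t : ℕ} :
      e.eval x m = 0 → Runs x q m t m' → Runs x (.cond e p q) m (e.cost x m + 1 + t) m'
  | loop_stop {e : RExp} {p : RProg} {m : ℕ → ℕ} :
      e.eval x m = 0 → Runs x (.loop e p) m (e.cost x m + 1) m
  | loop_step {e : RExp} {p : RProg} {m m' m'' : ℕ → ℕ} {t t' : ℕ} :
      e.eval x m ≠ 0 → Runs x p m t m' → Runs x (.loop e p) m' t' m'' →
      Runs x (.loop e p) m (e.cost x m + 1 + t + t') m''

/-- On input `x`, started with all registers `0`, the program `p` halts after time exactly `t`, and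
the content of register `0` is then `r`. -/
def Outputs (p : RProg) (x : List ℕ) (t r : ℕ) : Prop :=
  ∃ m : ℕ → ℕ, Runs x p (fun _ => 0) t m ∧ m 0 = r

end RAM

/-- A graph on `n` vertices as an input: the number `n`, followed by the `n * n` entries of the
adjacency matrix, row by row. -/
def encodeGraph {n : ℕ} (G : SimpleGraph (Fin n)) [DecidableRel G.Adj] : List ℕ :=
  n :: List.ofFn (fun p : Fin (n * n) => if G.Adj p.divNat p.modNat then 1 else 0)

/-- A graph and a number `k` as an input: the graph, followed by `k` ones. (With `k` in unary, a
program can notice that `k` is larger than `n` in time that depends on `n` only.) -/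
def encodeGraphNat {n : ℕ} (G : SimpleGraph (Fin n)) [DecidableRel G.Adj] (k : ℕ) : List ℕ :=
  encodeGraph G ++ List.replicate k 1

/-! Call a set two-sided if it and its complement are both dominating. For `q ≥ 1` there is a
packing with `q + 1` dominating sets exactly when some two-sided set `X` is the disjoint union of
`q` two-sided sets: given a packing, `X` is the union of all sets but the last; conversely, the
complement of `X` is the missing set (`partitions_iff_packing`). So the task is an exact cover
problem inside the family `F` of two-sided sets.

`F` is small. A two-sided set meets every closed neighbourhood in a nonempty proper subset. The
Chung–Frankl–Graham–Shearer inequality, applied to the closed neighbourhoods padded with singletons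
so that each vertex is covered `Δ + 1` times, gives `|F| ^ (Δ + 1) ≤ (2 ^ (Δ + 1) - 2) ^ n`. The
same bound holds when only the vertices below `i` are decided and only the closed neighbourhoods
below `i` are tested (`card_pow_le_of_splits`), so `F` can be listed vertex by vertex without ever
holding more candidates.

Covers are counted by a zeta transform, a `q`-th power and a Möbius inversion, one element at a
time, with entries at members of `F` only. This is legitimate because `F` is convex: if `X ∈ F` and
`X.erase i ∉ F`, then no member of `F` lies in `X.erase i`, and the missing entry is `0`
(`not_subset_erase_of_notMem_layer`). The weights `B ^ |S|` turn covers into partitions: a tuple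
with union `X` has weight exponent at least `|X|`, with equality iff it is disjoint, and as `B`
exceeds the number of tuples a remainder modulo `B ^ (|X| + 1)` detects equality
(`coverStage_mod_ne_zero_iff`).

On the machine all stored numbers have polynomially many bits, so each elementary step has
polynomial cost and it suffices to count steps; `Achieves` is a Hoare logic that does this. The
decision problem follows since a packing with `k` sets exists iff `k` is at most the domatic number.
-/

namespace RAM

/-! ### A structured language over tagged arrays

Every register of the machine is viewed as a cell of one of finitely many arrays; a scalar is the
cell `0` of its array. -/

/-- The names of the arrays. -/
inductive Tag : Type
  | out | n | base | i | j | b | u | v | q | bit | list | first | upto | last | cand | rest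
  | inside | outside | late | ok | weight | zeta | power | moebius | cur | acc | adj
  deriving DecidableEq

/-- The residue modulo `32` of the addresses of an array. -/
def Tag.code : Tag → ℕ
  | out => 0 | n => 1 | base => 2 | i => 3 | j => 4 | b => 5 | u => 6 | v => 7 | q => 8
  | bit => 9 | list => 10 | first => 11 | upto => 12 | last => 13 | cand => 14 | rest => 15
  | inside => 16 | outside => 17 | late => 18 | ok => 19 | weight => 20 | zeta => 21
  | power => 22 | moebius => 23 | cur => 24 | acc => 25 | adj => 26

theorem Tag.code_lt (t : Tag) : t.code < 32 := by cases t <;> decide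

theorem Tag.code_inj {t t' : Tag} (h : t.code = t'.code) : t = t' := by
  cases t <;> cases t' <;> first | rfl | exact absurd h (by decide)

/-- The contents of all arrays. -/
abbrev State := Tag → ℕ → ℕ

/-- Write a cell. -/
def State.upd (s : State) (t : Tag) (i v : ℕ) : State :=
  fun t' i' => if t' = t ∧ i' = i then v else s t' i'

theorem State.upd_apply (s : State) (t : Tag) (i v : ℕ) (t' : Tag) (i' : ℕ) :
    s.upd t i v t' i' = if t' = t ∧ i' = i then v else s t' i' := rfl

@[simp] theorem State.upd_same (s : State) (t : Tag) (i v : ℕ) : s.upd t i v t i = v := by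
  simp [State.upd]

theorem State.upd_ne (s : State) {t t' : Tag} (h : t' ≠ t) (i v : ℕ) :
    s.upd t i v t' = s t' := by
  funext i'; simp [State.upd, h]

/-- Expressions over the arrays. -/
inductive Ex : Type
  | lit : ℕ → Ex
  | inp : Ex → Ex
  | get : Tag → Ex → Ex
  | add : Ex → Ex → Ex
  | sub : Ex → Ex → Ex
  | mul : Ex → Ex → Ex
  | div : Ex → Ex → Ex

namespace Ex

/-- The value of an expression. -/
def eval (x : List ℕ) (s : State) : Ex → ℕ
  | lit c => c
  | inp a => x.getD (a.eval x s) 0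
  | get t a => s t (a.eval x s)
  | add a b => a.eval x s + b.eval x s
  | sub a b => a.eval x s - b.eval x s
  | mul a b => a.eval x s * b.eval x s
  | div a b => a.eval x s / b.eval x s

/-- The address of a cell. -/
def addr (t : Tag) (a : RExp) : RExp := .add (.mul (.lit 32) a) (.lit t.code)

/-- Translation to the machine. -/
def toRExp : Ex → RExp
  | lit c => .lit c
  | inp a => .inp a.toRExp
  | get t a => .mem (addr t a.toRExp)
  | add a b => .add a.toRExp b.toRExp
  | sub a b => .sub a.toRExp b.toRExp
  | mul a b => .mul a.toRExp b.toRExp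
  | div a b => .div a.toRExp b.toRExp

/-- The arrays that an expression reads. -/
def reads : Ex → List Tag
  | lit _ => []
  | inp a => a.reads
  | get t a => t :: a.reads
  | add a b => a.reads ++ b.reads
  | sub a b => a.reads ++ b.reads
  | mul a b => a.reads ++ b.reads
  | div a b => a.reads ++ b.reads

theorem eval_congr {x : List ℕ} {s s' : State} (e : Ex) (h : ∀ t ∈ e.reads, s t = s' t) :
    e.eval x s = e.eval x s' := by
  induction e with
  | lit c => rfl
  | inp a ih => simp only [eval]; rw [ih h]
  | get t a ih =>
    simp only [eval]
    rw [ih fun t ht => h t (List.mem_cons_of_mem _ ht), h t List.mem_cons_self]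
  | add a b iha ihb | sub a b iha ihb | mul a b iha ihb | div a b iha ihb =>
    simp only [eval]
    rw [iha fun t ht => h t (List.mem_append_left _ ht),
      ihb fun t ht => h t (List.mem_append_right _ ht)]

/-- The value of a scalar. -/
def var (t : Tag) : Ex := get t (lit 0)

@[simp] theorem eval_var (x : List ℕ) (s : State) (t : Tag) : (var t).eval x s = s t 0 := rfl

end Ex

/-- The memory `m` holds the arrays `s`. -/
def Rep (s : State) (m : ℕ → ℕ) : Prop := ∀ t i, m (32 * i + t.code) = s t i

theorem Rep.update {s : State} {m : ℕ → ℕ} (h : Rep s m) (t : Tag) (i v : ℕ) :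
    Rep (s.upd t i v) (Function.update m (32 * i + t.code) v) := by
  intro t' i'
  have h1 := t.code_lt
  have h2 := t'.code_lt
  by_cases hc : t' = t ∧ i' = i
  · obtain ⟨rfl, rfl⟩ := hc
    simp
  · rw [Function.update_of_ne, h, State.upd_apply, if_neg hc]
    intro he
    have hi : i' = i := by omega
    exact hc ⟨Tag.code_inj (by omega), hi⟩

theorem Ex.eval_toRExp {x : List ℕ} {s : State} {m : ℕ → ℕ} (h : Rep s m) (e : Ex) :
    e.toRExp.eval x m = e.eval x s := by
  induction e with
  | get t a ih => simp [toRExp, addr, RExp.eval, eval, ih, h t]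
  | _ => simp_all [toRExp, RExp.eval, eval]

/-! ### Cost of expressions -/

/-- The length of an expression. -/
def RExp.len : RExp → ℕ
  | .lit c => 1 + c.size
  | .inp a => a.len + 1
  | .mem a => a.len + 1
  | .add a b => a.len + b.len + 1
  | .sub a b => a.len + b.len + 1
  | .mul a b => a.len + b.len + 1
  | .div a b => a.len + b.len + 1

theorem size_add_le (a b : ℕ) : (a + b).size ≤ a.size + b.size + 1 := by
  rw [Nat.size_le]
  have ha := Nat.lt_size_self a
  have hb := Nat.lt_size_self b
  have h1 : 2 ^ a.size ≤ 2 ^ (a.size + b.size) := Nat.pow_le_pow_right (by norm_num) (by omega)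
  have h2 : 2 ^ b.size ≤ 2 ^ (a.size + b.size) := Nat.pow_le_pow_right (by norm_num) (by omega)
  rw [pow_succ]
  omega

theorem size_mul_le (a b : ℕ) : (a * b).size ≤ a.size + b.size := by
  rw [Nat.size_le, pow_add]
  exact Nat.mul_lt_mul'' (Nat.lt_size_self a) (Nat.lt_size_self b)

/-- Every operation at most adds the bit lengths of its operands, up to one extra bit, so bit length
grows linearly in the length of the expression. -/
theorem RExp.size_eval_le {x : List ℕ} {m : ℕ → ℕ} {w : ℕ} (hx : ∀ i, (x.getD i 0).size ≤ w)
    (hm : ∀ a, (m a).size ≤ w) (e : RExp) : (e.eval x m).size ≤ e.len * (w + 1) := by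
  induction e with
  | lit c => simp only [eval, len]; nlinarith [Nat.zero_le c.size, Nat.zero_le w]
  | inp a ih => simp only [eval, len]; nlinarith [hx (a.eval x m)]
  | mem a ih => simp only [eval, len]; nlinarith [hm (a.eval x m)]
  | add a b iha ihb => simp only [eval, len]; nlinarith [size_add_le (a.eval x m) (b.eval x m)]
  | sub a b iha ihb =>
    simp only [eval, len]
    nlinarith [Nat.size_le_size (Nat.sub_le (a.eval x m) (b.eval x m))]
  | mul a b iha ihb => simp only [eval, len]; nlinarith [size_mul_le (a.eval x m) (b.eval x m)]
  | div a b iha ihb =>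
    simp only [eval, len]
    nlinarith [Nat.size_le_size (Nat.div_le_self (a.eval x m) (b.eval x m))]

theorem RExp.len_pos (e : RExp) : 1 ≤ e.len := by cases e <;> simp only [len] <;> omega

/-- The square of the length is chosen because its cross terms absorb the product of bit lengths
charged for a multiplication or division. -/
theorem sq_len_bound {A B a b w ca cb : ℕ} (hA : 1 ≤ A) (ha : a ≤ A * (w + 1))
    (hb : b ≤ B * (w + 1)) (hca : ca ≤ A ^ 2 * (w + 1) ^ 2) (hcb : cb ≤ B ^ 2 * (w + 1) ^ 2) :
    ca + cb + (1 + a) * (1 + b) ≤ (A + B + 1) ^ 2 * (w + 1) ^ 2 ∧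
    ca + cb + (1 + a + b) ≤ (A + B + 1) ^ 2 * (w + 1) ^ 2 := by
  have h1 : (1 + a) * (1 + b) ≤ ((A + 1) * (w + 1)) * ((B + 1) * (w + 1)) :=
    Nat.mul_le_mul (by nlinarith) (by nlinarith)
  have h2 : ca + cb + (1 + a) * (1 + b) ≤ (A + B + 1) ^ 2 * (w + 1) ^ 2 := by
    calc ca + cb + (1 + a) * (1 + b)
        ≤ A ^ 2 * (w + 1) ^ 2 + B ^ 2 * (w + 1) ^ 2 + ((A + 1) * (w + 1)) * ((B + 1) * (w + 1)) :=
          by omega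
      _ = (A ^ 2 + B ^ 2 + (A + 1) * (B + 1)) * (w + 1) ^ 2 := by ring
      _ ≤ _ := Nat.mul_le_mul_right _ (by nlinarith)
  exact ⟨h2, le_trans (by nlinarith [Nat.zero_le (a * b)]) h2⟩

theorem RExp.cost_le {x : List ℕ} {m : ℕ → ℕ} {w : ℕ} (hx : ∀ i, (x.getD i 0).size ≤ w)
    (hm : ∀ a, (m a).size ≤ w) (e : RExp) : e.cost x m ≤ e.len ^ 2 * (w + 1) ^ 2 := by
  induction e with
  | lit c =>
    simp only [cost, len]
    calc 1 + c.size ≤ (1 + c.size) ^ 2 := Nat.le_self_pow (by norm_num) _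
      _ ≤ _ := Nat.le_mul_of_pos_right _ (by positivity)
  | inp a ih =>
    simp only [cost, len]
    have h1 := a.size_eval_le hx hm
    have h2 := hx (a.eval x m)
    have h3 := a.len_pos
    calc _ ≤ a.len ^ 2 * (w + 1) ^ 2 + (a.len + 1) * (w + 1) := by nlinarith
      _ ≤ a.len ^ 2 * (w + 1) ^ 2 + (a.len + 1) * (w + 1) ^ 2 := by gcongr; nlinarith
      _ ≤ _ := by nlinarith [Nat.zero_le ((w + 1) ^ 2), Nat.zero_le (a.len * (w + 1) ^ 2)]
  | mem a ih =>
    simp only [cost, len]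
    have h1 := a.size_eval_le hx hm
    have h2 := hm (a.eval x m)
    have h3 := a.len_pos
    calc _ ≤ a.len ^ 2 * (w + 1) ^ 2 + (a.len + 1) * (w + 1) := by nlinarith
      _ ≤ a.len ^ 2 * (w + 1) ^ 2 + (a.len + 1) * (w + 1) ^ 2 := by gcongr; nlinarith
      _ ≤ _ := by nlinarith [Nat.zero_le ((w + 1) ^ 2), Nat.zero_le (a.len * (w + 1) ^ 2)]
  | add a b iha ihb | sub a b iha ihb =>
    exact (sq_len_bound a.len_pos (a.size_eval_le hx hm) (b.size_eval_le hx hm) iha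
      ihb).2
  | mul a b iha ihb | div a b iha ihb =>
    exact (sq_len_bound a.len_pos (a.size_eval_le hx hm) (b.size_eval_le hx hm) iha
      ihb).1

/-! ### Programs -/

/-- Structured programs over the arrays. -/
inductive Pr : Type
  | skip : Pr
  | set : Tag → Ex → Ex → Pr
  | seq : Pr → Pr → Pr
  | ite : Ex → Pr → Pr → Pr
  | rep : Ex → Pr → Pr

namespace Pr

/-- Translation to the machine. -/
def toRProg : Pr → RProg
  | skip => .skip
  | set t a e => .store (Ex.addr t a.toRExp) e.toRExp
  | seq p q => .seq p.toRProg q.toRProg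
  | ite e p q => .cond e.toRExp p.toRProg q.toRProg
  | rep e p => .loop e.toRExp p.toRProg

/-- The arrays that a program writes. -/
def writes : Pr → List Tag
  | skip => []
  | set t _ _ => [t]
  | seq p q => p.writes ++ q.writes
  | ite _ p q => p.writes ++ q.writes
  | rep _ p => p.writes

/-- The length of a program. -/
def len : Pr → ℕ
  | skip => 1
  | set t a e => (Ex.addr t a.toRExp).len + e.toRExp.len + 1
  | seq p q => p.len + q.len
  | ite e p q => e.toRExp.len + p.len + q.len + 1
  | rep e p => e.toRExp.len + p.len + 1

/-- Assignment to a scalar. -/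
def assign (t : Tag) (e : Ex) : Pr := set t (.lit 0) e

/-- `forTo t b p` repeats `p` with `t` running from `0` to `b - 1`. -/
def forTo (t : Tag) (b : Ex) (p : Pr) : Pr :=
  seq (assign t (.lit 0))
    (.rep (.sub b (.var t)) (seq p (assign t (.add (.var t) (.lit 1)))))

/-- Different arrays occupy different residue classes modulo `32`, so a store to one array cannot
touch another, whatever the index. -/
theorem frame {x : List ℕ} (p : Pr) {m m' : ℕ → ℕ} {τ : ℕ} (h : Runs x p.toRProg m τ m') :
    ∀ t ∉ p.writes, ∀ i, m' (32 * i + t.code) = m (32 * i + t.code) := by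
  induction p generalizing m m' τ with
  | skip => cases h; intros; rfl
  | set t a e =>
    cases h
    intro t' ht' i
    rw [Function.update_of_ne]
    intro he
    have h1 := t.code_lt
    have h2 := t'.code_lt
    simp only [Ex.addr, RExp.eval] at he
    exact ht' (by simp only [writes, List.mem_singleton]; exact Tag.code_inj (by omega))
  | seq p q ihp ihq =>
    cases h with
    | seq h1 h2 =>
      intro t ht i
      simp only [writes, List.mem_append, not_or] at ht
      rw [ihq h2 t ht.2 i, ihp h1 t ht.1 i]
  | ite e p q ihp ihq =>
    intro t ht i
    simp only [writes, List.mem_append, not_or] at ht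
    cases h with
    | cond_true _ h1 => exact ihp h1 t ht.1 i
    | cond_false _ h1 => exact ihq h1 t ht.2 i
  | rep e p ih =>
    intro t ht i
    simp only [writes] at ht
    generalize hP : (Pr.rep e p).toRProg = P at h
    induction h with
    | skip | store | seq | cond_true | cond_false => simp [toRProg] at hP
    | loop_stop _ => rfl
    | loop_step _ h1 _ _ ih2 =>
      simp only [toRProg, RProg.loop.injEq] at hP
      obtain ⟨rfl, rfl⟩ := hP
      rw [ih2 rfl, ih h1 t ht i]

end Pr

/-! ### Program logic -/

/-- `Achieves x w p s T Q`: on inputs and arrays with entries below `2 ^ w`, the program `p`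
started at `s` keeps all entries below `2 ^ w`, halts after at most `T` steps, each of them charged
`p.len ^ 2 * (w + 1) ^ 2`, and then satisfies `Q`. -/
def Achieves (x : List ℕ) (w : ℕ) (p : Pr) (s : State) (T : ℕ) (Q : State → Prop) : Prop :=
  (∀ i, x.getD i 0 < 2 ^ w) → ∀ m, Rep s m → (∀ a, m a < 2 ^ w) →
    ∃ τ m' s', Runs x p.toRProg m τ m' ∧ Rep s' m' ∧ (∀ a, m' a < 2 ^ w) ∧
      τ ≤ T * (p.len ^ 2 * (w + 1) ^ 2) ∧ Q s'

namespace Achieves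

variable {x : List ℕ} {w : ℕ}

theorem mono {p : Pr} {s : State} {T T' : ℕ} {Q Q' : State → Prop} (h : Achieves x w p s T Q)
    (hT : T ≤ T') (hQ : ∀ s', Q s' → Q' s') : Achieves x w p s T' Q' := by
  intro hx m hs hm
  obtain ⟨τ, m', s', h1, h2, h3, h4, h5⟩ := h hx m hs hm
  exact ⟨τ, m', s', h1, h2, h3, h4.trans (Nat.mul_le_mul_right _ hT), hQ _ h5⟩

/-- Arrays that a program does not write keep their contents. -/
theorem with_frame {p : Pr} {s : State} {T : ℕ} {Q : State → Prop} (h : Achieves x w p s T Q) :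
    Achieves x w p s T (fun s' => Q s' ∧ ∀ t ∉ p.writes, s' t = s t) := by
  intro hx m hs hm
  obtain ⟨τ, m', s', h1, h2, h3, h4, h5⟩ := h hx m hs hm
  refine ⟨τ, m', s', h1, h2, h3, h4, h5, fun t ht => funext fun i => ?_⟩
  rw [← h2 t i, ← hs t i, p.frame h1 t ht i]

theorem skip {s : State} {Q : State → Prop} (h : Q s) : Achieves x w .skip s 1 Q := by
  intro _ m hs hm
  refine ⟨1, m, s, Runs.skip m, hs, hm, ?_, h⟩
  simp only [Pr.len]
  nlinarith [Nat.zero_le w]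

/-- Only the stored value needs a bound. The address may exceed `2 ^ w`; its cost is controlled by
the length of its expression. -/
theorem set {t : Tag} {a e : Ex} {s : State} {Q : State → Prop} (he : e.eval x s < 2 ^ w)
    (h : Q (s.upd t (a.eval x s) (e.eval x s))) : Achieves x w (.set t a e) s 1 Q := by
  intro hx m hs hm
  have hx' : ∀ i, (x.getD i 0).size ≤ w := fun i => Nat.size_le.2 (hx i)
  have hm' : ∀ i, (m i).size ≤ w := fun i => Nat.size_le.2 (hm i)
  refine ⟨_, _, s.upd t (a.eval x s) (e.eval x s), Runs.store _ _ m, ?_, ?_, ?_, h⟩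
  · simp only [Ex.addr, RExp.eval, Ex.eval_toRExp hs]
    exact hs.update _ _ _
  · intro b
    rw [Function.update_apply]
    split_ifs
    · rwa [Ex.eval_toRExp hs]
    · exact hm b
  · rw [one_mul]
    exact (sq_len_bound (RExp.len_pos _) (RExp.size_eval_le hx' hm' _)
      (RExp.size_eval_le hx' hm' _) (RExp.cost_le hx' hm' _) (RExp.cost_le hx' hm' _)).2

theorem assign {t : Tag} {e : Ex} {s : State} {Q : State → Prop} (he : e.eval x s < 2 ^ w)
    (h : Q (s.upd t 0 (e.eval x s))) : Achieves x w (.assign t e) s 1 Q := set he h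

theorem seq {p q : Pr} {s : State} {T T' : ℕ} {Q : State → Prop}
    (h : Achieves x w p s T (fun s' => Achieves x w q s' T' Q)) :
    Achieves x w (.seq p q) s (T + T') Q := by
  intro hx m hs hm
  obtain ⟨τ, m', s', h1, h2, h3, h4, h5⟩ := h hx m hs hm
  obtain ⟨τ', m'', s'', h1', h2', h3', h4', h5'⟩ := h5 hx m' h2 h3
  refine ⟨τ + τ', m'', s'', h1.seq h1', h2', h3', ?_, h5'⟩
  have e1 : T * (p.len ^ 2 * (w + 1) ^ 2) ≤ T * ((p.len + q.len) ^ 2 * (w + 1) ^ 2) := by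
    gcongr; omega
  have e2 : T' * (q.len ^ 2 * (w + 1) ^ 2) ≤ T' * ((p.len + q.len) ^ 2 * (w + 1) ^ 2) := by
    gcongr; omega
  simp only [Pr.len]
  rw [add_mul]
  omega

theorem test_cost {e : Ex} {m : ℕ → ℕ} {L : ℕ} (hx : ∀ i, x.getD i 0 < 2 ^ w)
    (hm : ∀ a, m a < 2 ^ w) (hL : e.toRExp.len + 1 ≤ L) :
    e.toRExp.cost x m + 1 ≤ L ^ 2 * (w + 1) ^ 2 := by
  have h := RExp.cost_le (fun i => Nat.size_le.2 (hx i)) (fun i => Nat.size_le.2 (hm i)) e.toRExp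
  calc _ ≤ e.toRExp.len ^ 2 * (w + 1) ^ 2 + 1 * (w + 1) ^ 2 := by nlinarith [Nat.zero_le w]
    _ = (e.toRExp.len ^ 2 + 1) * (w + 1) ^ 2 := by ring
    _ ≤ _ := Nat.mul_le_mul_right _ (by nlinarith)

theorem ite {e : Ex} {p q : Pr} {s : State} {T : ℕ} {Q : State → Prop}
    (h1 : e.eval x s ≠ 0 → Achieves x w p s T Q) (h0 : e.eval x s = 0 → Achieves x w q s T Q) :
    Achieves x w (.ite e p q) s (T + 1) Q := by
  intro hx m hs hm
  have hc := test_cost (e := e) (L := (Pr.ite e p q).len) hx hm (by simp only [Pr.len]; omega)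
  by_cases he : e.eval x s = 0
  · obtain ⟨τ, m', s', k1, k2, k3, k4, k5⟩ := h0 he hx m hs hm
    refine ⟨_, m', s', Runs.cond_false (by rwa [Ex.eval_toRExp hs]) k1, k2, k3, ?_, k5⟩
    have : T * (q.len ^ 2 * (w + 1) ^ 2) ≤ T * ((Pr.ite e p q).len ^ 2 * (w + 1) ^ 2) := by
      gcongr; simp only [Pr.len]; omega
    rw [add_mul, one_mul]
    omega
  · obtain ⟨τ, m', s', k1, k2, k3, k4, k5⟩ := h1 he hx m hs hm
    refine ⟨_, m', s', Runs.cond_true (by rwa [Ex.eval_toRExp hs]) k1, k2, k3, ?_, k5⟩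
    have : T * (p.len ^ 2 * (w + 1) ^ 2) ≤ T * ((Pr.ite e p q).len ^ 2 * (w + 1) ^ 2) := by
      gcongr; simp only [Pr.len]; omega
    rw [add_mul, one_mul]
    omega

/-- The test evaluates to exactly `N - j` in round `j`, so the loop stops after the remaining
rounds; each costs `T` steps and one test, and the final test accounts for the `+ 1`. -/
theorem rep_of_count {e : Ex} {p : Pr} {N T : ℕ} (Inv : ℕ → State → Prop)
    (he : ∀ j ≤ N, ∀ s, Inv j s → e.eval x s = N - j)
    (hp : ∀ j < N, ∀ s, Inv j s → Achieves x w p s T (Inv (j + 1)))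
    {j : ℕ} (hj : j ≤ N) {s : State} (hs : Inv j s) :
    Achieves x w (.rep e p) s ((N - j) * (T + 1) + 1) (Inv N) := by
  induction hk : N - j generalizing j s with
  | zero =>
    intro hx m hm hb
    have hc := test_cost (e := e) (L := (Pr.rep e p).len) hx hb (by simp only [Pr.len]; omega)
    obtain rfl : j = N := by omega
    refine ⟨_, m, s, Runs.loop_stop (by rw [Ex.eval_toRExp hm, he _ le_rfl s hs]; omega), hm, hb,
      ?_, hs⟩
    omega
  | succ k ih =>
    intro hx m hm hb
    have hc := test_cost (e := e) (L := (Pr.rep e p).len) hx hb (by simp only [Pr.len]; omega)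
    obtain ⟨τ, m', s', k1, k2, k3, k4, k5⟩ := hp j (by omega) s hs hx m hm hb
    obtain ⟨τ', m'', s'', r1, r2, r3, r4, r5⟩ :=
      ih (j := j + 1) (by omega) k5 (by omega) hx m' k2 k3
    refine ⟨_, m'', s'', Runs.loop_step (by rw [Ex.eval_toRExp hm, he j hj s hs]; omega) k1 r1, r2,
      r3, ?_, r5⟩
    have : T * (p.len ^ 2 * (w + 1) ^ 2) ≤ T * ((Pr.rep e p).len ^ 2 * (w + 1) ^ 2) := by
      gcongr; simp only [Pr.len]; omega
    calc _ ≤ (1 + T + (k * (T + 1) + 1)) * ((Pr.rep e p).len ^ 2 * (w + 1) ^ 2) := by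
          rw [add_mul, add_mul, one_mul]; omega
      _ = _ := by ring

/-- The rule for counting loops. The invariant may use that whatever is not written by the loop is
as it was before. -/
theorem forTo {t : Tag} {b : Ex} {p : Pr} {s : State} {N T : ℕ} (Inv : ℕ → State → Prop)
    (hb : ∀ t' ∈ b.reads, t' ∉ t :: p.writes) (ht : t ∉ p.writes)
    (hN : b.eval x s = N) (hNw : N < 2 ^ w)
    (h0 : Inv 0 (s.upd t 0 0))
    (hp : ∀ j < N, ∀ s', Inv j s' → s' t 0 = j → (∀ t' ∉ t :: p.writes, s' t' = s t') →
      Achieves x w p s' T (fun s'' => s'' t 0 = j →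
        (∀ t' ∉ t :: p.writes, s'' t' = s t') → Inv (j + 1) (s''.upd t 0 (j + 1)))) :
    Achieves x w (.forTo t b p) s (N * (T + 2) + 2) (fun s' => Inv N s' ∧
      ∀ t' ∉ t :: p.writes, s' t' = s t') := by
  have key : Achieves x w (.rep (.sub b (.var t)) (.seq p (.assign t (.add (.var t) (.lit 1)))))
      (s.upd t 0 0) ((N - 0) * (T + 1 + 1) + 1)
      (fun s' => Inv N s' ∧ s' t 0 = N ∧ ∀ t' ∉ t :: p.writes, s' t' = s t') := by
    refine rep_of_count
      (fun j s' => Inv j s' ∧ s' t 0 = j ∧ ∀ t' ∉ t :: p.writes, s' t' = s t') ?_ ?_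
      (Nat.zero_le N) ⟨h0, by simp, fun t' ht' => ?_⟩
    · rintro j hj s' ⟨_, h2, h3⟩
      simp only [Ex.eval, Ex.eval_var, h2]
      rw [Ex.eval_congr b fun t' ht' => h3 t' (hb t' ht'), hN]
    · rintro j hj s' ⟨h1, h2, h3⟩
      refine seq ((hp j hj s' h1 h2 h3).with_frame.mono le_rfl ?_)
      rintro s'' ⟨k1, k2⟩
      have k3 : s'' t 0 = j := by rw [k2 t ht, h2]
      have k4 : ∀ t' ∉ t :: p.writes, s'' t' = s t' := fun t' ht' => by
        rw [k2 t' fun h => ht' (List.mem_cons_of_mem _ h), h3 t' ht']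
      have k5 : (Ex.add (.var t) (.lit 1)).eval x s'' = j + 1 := by simp [Ex.eval, k3]
      refine assign (by rw [k5]; omega) ?_
      rw [k5]
      refine ⟨k1 k3 k4, by simp, fun t' ht' => ?_⟩
      rw [State.upd_ne _ (fun h => ht' (by simp [h])), k4 t' ht']
    · rw [State.upd_ne _ (fun h => ht' (by simp [h]))]
  refine mono (seq (assign (by simp [Ex.eval]) key)) ?_ fun s' h => ⟨h.1, h.2.2⟩
  rw [Nat.sub_zero]
  exact le_of_eq (by ring)

end Achieves

end RAM

/-! ### The algorithm on finite sets, without the machine. -/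

namespace Domatic

open Finset

/-! ### Finite sets of natural numbers as bit masks -/

/-- The number whose binary digits are the indicator of `S`. -/
def mask (S : Finset ℕ) : ℕ := ∑ i ∈ S, 2 ^ i

theorem mask_injective : Function.Injective mask := Finset.geomSum_injective le_rfl

@[simp] theorem mask_empty : mask ∅ = 0 := rfl

theorem mask_lt {S : Finset ℕ} {n : ℕ} (h : S ⊆ range n) : mask S < 2 ^ n :=
  Nat.geomSum_lt le_rfl fun _ hk => mem_range.1 (h hk)

theorem mask_insert {S : Finset ℕ} {i : ℕ} (h : i ∉ S) : mask (insert i S) = mask S + 2 ^ i := by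
  rw [mask, sum_insert h, add_comm, mask]

theorem mask_erase {S : Finset ℕ} {i : ℕ} (h : i ∈ S) : mask (S.erase i) = mask S - 2 ^ i := by
  conv_rhs => rw [← insert_erase h, mask_insert (notMem_erase i S)]
  simp

theorem mask_div_mod (S : Finset ℕ) (i : ℕ) : mask S / 2 ^ i % 2 = if i ∈ S then 1 else 0 := by
  have h : i ∈ S ↔ (mask S).testBit i = true := by
    rw [← Nat.mem_bitIndices, ← List.mem_toFinset, mask, toFinset_bitIndices_sum_two_pow]
  rw [Nat.testBit_eq_decide_div_mod_eq, decide_eq_true_eq] at h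
  split_ifs with hi
  · exact h.1 hi
  · have := mt h.2 hi
    omega

/-! ### Enumerating the two-sided transversals of a set system -/

/-- `S` meets, and does not contain, each of the sets `nb v`, `v < n`, that are contained in
`{0, …, i - 1}`. -/
def Splits (nb : ℕ → Finset ℕ) (n i : ℕ) (S : Finset ℕ) : Prop :=
  ∀ v < n, nb v ⊆ range i → (nb v ∩ S).Nonempty ∧ ¬ nb v ⊆ S

instance (nb : ℕ → Finset ℕ) (n i : ℕ) : DecidablePred (Splits nb n i) := fun S => by
  unfold Splits; infer_instance

/-- The extensions of a subset of `{0, …, i - 1}` to subsets of `{0, …, i}` that are not yet ruled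
out. -/
def children (nb : ℕ → Finset ℕ) (n i : ℕ) (S : Finset ℕ) : List (Finset ℕ) :=
  [S, insert i S].filter fun Y => Splits nb n (i + 1) Y

/-- The list of the subsets of `{0, …, i - 1}` that are not yet ruled out. -/
def layer (nb : ℕ → Finset ℕ) (n : ℕ) : ℕ → List (Finset ℕ)
  | 0 => [∅]
  | i + 1 => (layer nb n i).flatMap (children nb n i)

section layer

variable {nb : ℕ → Finset ℕ} {n : ℕ}

/-- A set inside `range i` cannot see elements from `i` on. Hence pruning never removes an ancestor
of a surviving set. -/
theorem Splits.inter_range {i : ℕ} {S : Finset ℕ} (h : Splits nb n (i + 1) S) :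
    Splits nb n i (S ∩ range i) := by
  intro v hv hs
  have hs' : nb v ⊆ range (i + 1) := hs.trans (range_subset_range.2 (Nat.le_succ i))
  obtain ⟨⟨u, hu⟩, h2⟩ := h v hv hs'
  rw [mem_inter] at hu
  exact ⟨⟨u, by simp [hu.1, hu.2, mem_range.1 (hs hu.1)]⟩, fun hc => h2 fun u hu =>
    (mem_inter.1 (hc hu)).1⟩

theorem mem_children {i : ℕ} {S Y : Finset ℕ} :
    Y ∈ children nb n i S ↔ (Y = S ∨ Y = insert i S) ∧ Splits nb n (i + 1) Y := by
  simp [children]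

/-- Each set is reached from its truncation. Nonemptiness matters only at `i = 0`, where an empty
`nb v` would already rule out `∅`. -/
theorem mem_layer (hnb : ∀ v < n, (nb v).Nonempty) {i : ℕ} {S : Finset ℕ} :
    S ∈ layer nb n i ↔ S ⊆ range i ∧ Splits nb n i S := by
  induction i generalizing S with
  | zero =>
    simp only [layer, List.mem_singleton, range_zero, subset_empty, iff_self_and]
    rintro _ v hv hs
    exact absurd (hnb v hv) (by simp [subset_empty.1 hs])
  | succ i ih =>
    simp only [layer, List.mem_flatMap, mem_children, ih]
    constructor
    · rintro ⟨R, ⟨hR, _⟩, h, hs⟩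
      refine ⟨?_, hs⟩
      have hR' : R ⊆ range (i + 1) := hR.trans (range_subset_range.2 (Nat.le_succ i))
      rcases h with rfl | rfl
      · exact hR'
      · exact insert_subset (by simp) hR'
    · rintro ⟨hS, hs⟩
      refine ⟨S ∩ range i, ⟨inter_subset_right, hs.inter_range⟩, ?_, hs⟩
      by_cases hi : i ∈ S
      · right
        ext v
        have := @hS v
        simp only [mem_insert, mem_inter, mem_range] at this ⊢
        constructor
        · intro hv
          have := this hv
          by_cases h : v = i
          · exact Or.inl h
          · exact Or.inr ⟨hv, by omega⟩
        · rintro (rfl | h)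
          · exact hi
          · exact h.1
      · left
        ext v
        have := @hS v
        simp only [mem_inter, mem_range] at this ⊢
        refine ⟨fun hv => ⟨hv, ?_⟩, fun h => h.1⟩
        have := this hv
        have : v ≠ i := fun h => hi (h ▸ hv)
        omega

/-- A child determines its parent by erasing `i`. Absence of repetitions lets the length of the list
be bounded by the size of the family. -/
theorem nodup_layer (hnb : ∀ v < n, (nb v).Nonempty) (i : ℕ) : (layer nb n i).Nodup := by
  induction i with
  | zero => simp [layer]
  | succ i ih =>
    rw [layer, List.nodup_flatMap]
    have hmem : ∀ S ∈ layer nb n i, i ∉ S := fun S hS hi => by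
      simpa using ((mem_layer hnb).1 hS).1 hi
    refine ⟨fun S hS => ?_, ?_⟩
    · refine List.Nodup.filter _ ?_
      have hne : S ≠ insert i S := fun h => hmem S hS (by rw [h]; exact mem_insert_self i S)
      simp [hne]
    · refine ih.imp_of_mem ?_
      intro S T hS hT hne Y hY hY'
      rw [mem_children] at hY hY'
      have h1 := hmem S hS
      have h2 := hmem T hT
      have e : Y.erase i = S := by
        rcases hY.1 with rfl | rfl
        · exact erase_eq_of_notMem h1
        · exact erase_insert h1
      have e' : Y.erase i = T := by
        rcases hY'.1 with rfl | rfl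
        · exact erase_eq_of_notMem h2
        · exact erase_insert h2
      exact hne (e ▸ e')

end layer

/-! ### Zeta and Möbius transforms, one element at a time -/

section transforms

variable (F : Finset (Finset ℕ)) (f : Finset ℕ → ℕ)

/-- The zeta transform of `f` on `F` in the directions below `i`. -/
def zetaStage (i : ℕ) (X : Finset ℕ) : ℕ :=
  ∑ S ∈ F with S ⊆ X ∧ ∀ v ∈ X, v ∉ S → v < i, f S

/-- The `q`-tuples of members of `F` contained in `X` that cover the elements of `X` below `i`,
counted with weights. -/
def coverStage (q i : ℕ) (X : Finset ℕ) : ℕ :=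
  ∑ τ ∈ Fintype.piFinset (fun _ : Fin q => F) with
    (∀ k, τ k ⊆ X) ∧ ∀ v ∈ X, v < i → ∃ k, v ∈ τ k, ∏ k, f (τ k)

variable {F f}

theorem zetaStage_zero (X : Finset ℕ) : zetaStage F f 0 X = if X ∈ F then f X else 0 := by
  rw [zetaStage, ← sum_filter_add_sum_filter_not _ (· = X)]
  rw [filter_filter, filter_filter]
  have h2 : F.filter (fun S => (S ⊆ X ∧ ∀ v ∈ X, v ∉ S → v < 0) ∧ ¬ S = X) = ∅ := by
    refine filter_eq_empty_iff.2 fun S _ h => h.2 (h.1.1.antisymm fun v hv => ?_)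
    by_contra hvS
    exact absurd (h.1.2 v hv hvS) (Nat.not_lt_zero v)
  have h1 : F.filter (fun S => (S ⊆ X ∧ ∀ v ∈ X, v ∉ S → v < 0) ∧ S = X) = F.filter (X = ·) := by
    refine filter_congr fun S _ => ⟨fun h => h.2.symm, fun h => ?_⟩
    subst h
    exact ⟨⟨Subset.rfl, fun v hv hv' => absurd hv hv'⟩, rfl⟩
  rw [h1, h2, sum_empty, add_zero, filter_eq]
  split_ifs <;> simp

/-- For `i ∈ X`, the sets containing `i` were counted at stage `i` for `X`; those omitting `i` were
counted at stage `i` for `X.erase i`. -/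
theorem zetaStage_succ (i : ℕ) (X : Finset ℕ) :
    zetaStage F f (i + 1) X =
      if i ∈ X then zetaStage F f i X + zetaStage F f i (X.erase i) else zetaStage F f i X := by
  split_ifs with hi
  · rw [zetaStage, ← sum_filter_add_sum_filter_not _ (i ∈ ·), filter_filter, filter_filter]
    congr 1
    · refine sum_congr (filter_congr fun S _ => ⟨?_, ?_⟩) fun _ _ => rfl
      · rintro ⟨⟨h1, h2⟩, h3⟩
        refine ⟨h1, fun v hv hvS => ?_⟩
        have := h2 v hv hvS
        have : v ≠ i := fun h => hvS (h ▸ h3)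
        omega
      · rintro ⟨h1, h2⟩
        refine ⟨⟨h1, fun v hv hvS => (h2 v hv hvS).trans (Nat.lt_succ_self i)⟩, ?_⟩
        by_contra h
        exact absurd (h2 i hi h) (lt_irrefl i)
    · refine sum_congr (filter_congr fun S _ => ⟨?_, ?_⟩) fun _ _ => rfl
      · rintro ⟨⟨h1, h2⟩, h3⟩
        refine ⟨subset_erase.2 ⟨h1, h3⟩, fun v hv hvS => ?_⟩
        rw [mem_erase] at hv
        have := h2 v hv.2 hvS
        have := hv.1
        omega
      · rintro ⟨h1, h2⟩
        rw [subset_erase] at h1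
        refine ⟨⟨h1.1, fun v hv hvS => ?_⟩, h1.2⟩
        by_cases hvi : v = i
        · omega
        · exact (h2 v (mem_erase.2 ⟨hvi, hv⟩) hvS).trans (Nat.lt_succ_self i)
  · refine sum_congr (filter_congr fun S _ => and_congr_right fun _ =>
      forall₂_congr fun v hv => imp_congr_right fun _ => ?_) fun _ _ => rfl
    have : v ≠ i := fun h => hi (h ▸ hv)
    omega

theorem zetaStage_last {n : ℕ} {X : Finset ℕ} (hX : X ⊆ range n) :
    zetaStage F f n X = ∑ S ∈ F with S ⊆ X, f S :=
  sum_congr (filter_congr fun _ _ => and_iff_left fun _ hv _ => mem_range.1 (hX hv))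
    fun _ _ => rfl

theorem zetaStage_le (i : ℕ) (X : Finset ℕ) : zetaStage F f i X ≤ ∑ S ∈ F with S ⊆ X, f S :=
  sum_le_sum_of_subset (monotone_filter_right F fun _ _ h => h.1)

theorem zetaStage_eq_zero {X : Finset ℕ} (hX : ∀ S ∈ F, ¬ S ⊆ X) (i : ℕ) :
    zetaStage F f i X = 0 := by
  rw [zetaStage, filter_eq_empty_iff.2 fun S hS h => hX S hS h.1, sum_empty]

/-- With no covering condition the sum over tuples factors as a power of the zeta transform. -/
theorem coverStage_zero (q : ℕ) (X : Finset ℕ) :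
    coverStage F f q 0 X = (∑ S ∈ F with S ⊆ X, f S) ^ q := by
  have h := prod_univ_sum (ι := Fin q) (fun _ => F.filter (· ⊆ X)) (fun _ S => f S)
  rw [prod_const, card_univ, Fintype.card_fin] at h
  rw [h]
  refine sum_congr ?_ fun _ _ => rfl
  ext τ
  simp [forall_and]

/-- The tuples that fail to cover `i` are precisely those living in `X.erase i`, so this is Möbius
inversion in direction `i`, and the truncated subtraction is exact. -/
theorem coverStage_succ (q i : ℕ) (X : Finset ℕ) :
    coverStage F f q (i + 1) X =
      if i ∈ X then coverStage F f q i X - coverStage F f q i (X.erase i)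
      else coverStage F f q i X := by
  split_ifs with hi
  · refine (Nat.sub_eq_of_eq_add ?_).symm
    rw [coverStage, ← sum_filter_add_sum_filter_not _ (fun τ => ∃ k, i ∈ τ k), filter_filter,
      filter_filter]
    congr 1
    · refine sum_congr (filter_congr fun τ _ => ⟨?_, ?_⟩) fun _ _ => rfl
      · rintro ⟨⟨h1, h2⟩, h3⟩
        refine ⟨h1, fun v hv hvi => ?_⟩
        by_cases h : v = i
        · exact h ▸ h3
        · exact h2 v hv (by omega)
      · rintro ⟨h1, h2⟩
        exact ⟨⟨h1, fun v hv hvi => h2 v hv (by omega)⟩, h2 i hi (Nat.lt_succ_self i)⟩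
    · refine sum_congr (filter_congr fun τ _ => ⟨?_, ?_⟩) fun _ _ => rfl
      · rintro ⟨⟨h1, h2⟩, h3⟩
        refine ⟨fun k => subset_erase.2 ⟨h1 k, fun h => h3 ⟨k, h⟩⟩, fun v hv hvi => ?_⟩
        exact h2 v (mem_of_mem_erase hv) hvi
      · rintro ⟨h1, h2⟩
        refine ⟨⟨fun k => (subset_erase.1 (h1 k)).1, fun v hv hvi => ?_⟩, fun ⟨k, hk⟩ =>
          (subset_erase.1 (h1 k)).2 hk⟩
        exact h2 v (mem_erase.2 ⟨by omega, hv⟩) hvi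
  · refine sum_congr (filter_congr fun τ _ => and_congr_right fun _ =>
      forall₂_congr fun v hv => ?_) fun _ _ => rfl
    have : v ≠ i := fun h => hi (h ▸ hv)
    exact imp_congr_left (by omega)

theorem coverStage_le (q i : ℕ) (X : Finset ℕ) :
    coverStage F f q i X ≤ (∑ S ∈ F with S ⊆ X, f S) ^ q := by
  rw [← coverStage_zero]
  exact sum_le_sum_of_subset (monotone_filter_right _ fun _ _ h => ⟨h.1, by simp⟩)

/-- The empty tuple lies in every `X`, hence the condition `q ≠ 0`. -/
theorem coverStage_eq_zero {q : ℕ} (hq : q ≠ 0) {X : Finset ℕ} (hX : ∀ S ∈ F, ¬ S ⊆ X) (i : ℕ) :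
    coverStage F f q i X = 0 := by
  rw [coverStage, filter_eq_empty_iff.2, sum_empty]
  intro τ hτ h
  exact hX _ (Fintype.mem_piFinset.1 hτ ⟨0, Nat.pos_of_ne_zero hq⟩) (h.1 _)

end transforms

/-! ### Reading off exact partitions -/

theorem card_biUnion_lt_of_not_disjoint {q : ℕ} {τ : Fin q → Finset ℕ} {k l : Fin q} (hkl : k ≠ l)
    (h : ¬ Disjoint (τ k) (τ l)) : (univ.biUnion τ).card < ∑ k, (τ k).card := by
  obtain ⟨v, hvk, hvl⟩ := not_disjoint_iff.1 h
  -- Dropping the shared element from one of the two sets keeps the union but lowers the sum of the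
  -- cardinalities.
  set σ := Function.update τ k ((τ k).erase v) with hσ
  have hU : univ.biUnion τ ⊆ univ.biUnion σ := by
    intro u hu
    obtain ⟨a, -, ha⟩ := mem_biUnion.1 hu
    rw [mem_biUnion]
    by_cases hak : a = k
    · subst hak
      by_cases huv : u = v
      · exact ⟨l, mem_univ _, by simpa [hσ, hkl.symm, huv] using hvl⟩
      · exact ⟨a, mem_univ _, by simp [hσ, huv, ha]⟩
    · exact ⟨a, mem_univ _, by simpa [hσ, hak] using ha⟩
  calc (univ.biUnion τ).card ≤ (univ.biUnion σ).card := card_le_card hU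
    _ ≤ ∑ a, (σ a).card := card_biUnion_le
    _ < ∑ a, (τ a).card := by
      refine sum_lt_sum (fun a _ => ?_) ⟨k, mem_univ _, ?_⟩
      · by_cases hak : a = k
        · subst hak; simpa [hσ] using card_le_card (erase_subset v (τ a))
        · simp [hσ, hak]
      · simpa [hσ] using card_erase_lt_of_mem hvk

/-- Modulo `B ^ (d + 1)` only the terms with exponent `d` remain, and there are fewer than `B` of
them, so they cannot add up to a multiple of `B ^ (d + 1)` unless there are none. -/
theorem mod_pow_ne_zero_iff {ι : Type*} (s : Finset ι) (e : ι → ℕ) {B d : ℕ} (hB : s.card < B)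
    (he : ∀ a ∈ s, d ≤ e a) : (∑ a ∈ s, B ^ e a) % B ^ (d + 1) ≠ 0 ↔ ∃ a ∈ s, e a = d := by
  have hB0 : 0 < B := by omega
  have h1 : ∑ a ∈ s with e a = d, B ^ e a = (s.filter (e · = d)).card * B ^ d := by
    rw [sum_congr rfl fun a ha => by rw [(mem_filter.1 ha).2], sum_const, smul_eq_mul]
  have h2 : B ^ (d + 1) ∣ ∑ a ∈ s with ¬ e a = d, B ^ e a := by
    refine dvd_sum fun a ha => pow_dvd_pow B ?_
    rw [mem_filter] at ha
    have := he a ha.1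
    omega
  have h3 : (s.filter (e · = d)).card * B ^ d < B ^ (d + 1) := by
    rw [pow_succ, mul_comm]
    exact Nat.mul_lt_mul_of_pos_left ((card_filter_le _ _).trans_lt hB) (by positivity)
  obtain ⟨c, hc⟩ := h2
  rw [← sum_filter_add_sum_filter_not s (e · = d), h1, hc, Nat.add_mul_mod_self_left,
    Nat.mod_eq_of_lt h3, Ne, mul_eq_zero, not_or]
  constructor
  · rintro ⟨h, -⟩
    obtain ⟨a, ha⟩ := card_ne_zero.1 h
    exact ⟨a, mem_filter.1 ha⟩
  · rintro ⟨a, ha⟩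
    exact ⟨card_ne_zero.2 ⟨a, mem_filter.2 ha⟩, by positivity⟩

/-- A member of `F ^ q` partitions `X`. -/
def Partitions (F : Finset (Finset ℕ)) (q : ℕ) (X : Finset ℕ) : Prop :=
  ∃ τ : Fin q → Finset ℕ, (∀ k, τ k ∈ F) ∧ (∀ k l, k ≠ l → Disjoint (τ k) (τ l)) ∧
    univ.biUnion τ = X

/-- The exponent of a covering tuple is the sum of its cardinalities, which attains its minimum
`|X|` exactly for disjoint tuples. -/
theorem coverStage_mod_ne_zero_iff {F : Finset (Finset ℕ)} {q n B : ℕ} (hB : F.card ^ q < B)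
    {X : Finset ℕ} (hX : X ⊆ range n) :
    coverStage F (fun S => B ^ S.card) q n X % B ^ (X.card + 1) ≠ 0 ↔ Partitions F q X := by
  have hset : ∀ τ : Fin q → Finset ℕ, ((∀ k, τ k ⊆ X) ∧ ∀ v ∈ X, v < n → ∃ k, v ∈ τ k) ↔
      univ.biUnion τ = X := by
    intro τ
    constructor
    · rintro ⟨h1, h2⟩
      refine (biUnion_subset.2 fun k _ => h1 k).antisymm fun v hv => ?_
      obtain ⟨k, hk⟩ := h2 v hv (mem_range.1 (hX hv))
      exact mem_biUnion.2 ⟨k, mem_univ _, hk⟩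
    · rintro rfl
      refine ⟨fun k => subset_biUnion_of_mem τ (mem_univ k), fun v hv _ => ?_⟩
      obtain ⟨k, -, hk⟩ := mem_biUnion.1 hv
      exact ⟨k, hk⟩
  have : coverStage F (fun S => B ^ S.card) q n X =
      ∑ τ ∈ Fintype.piFinset (fun _ : Fin q => F) with univ.biUnion τ = X,
        B ^ ∑ k, (τ k).card := by
    refine sum_congr (filter_congr fun τ _ => hset τ) fun τ _ => ?_
    rw [prod_pow_eq_pow_sum]
  rw [this, mod_pow_ne_zero_iff]
  · constructor
    · rintro ⟨τ, hτ, hc⟩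
      rw [mem_filter, Fintype.mem_piFinset] at hτ
      refine ⟨τ, hτ.1, fun k l hkl => ?_, hτ.2⟩
      by_contra h
      have := card_biUnion_lt_of_not_disjoint hkl h
      rw [hτ.2] at this
      omega
    · rintro ⟨τ, h1, h2, h3⟩
      refine ⟨τ, mem_filter.2 ⟨Fintype.mem_piFinset.2 h1, h3⟩, ?_⟩
      rw [← h3, card_biUnion fun k _ l _ hkl => h2 k l hkl]
  · refine (card_filter_le _ _).trans_lt ?_
    simpa using hB
  · intro τ hτ
    rw [← (mem_filter.1 hτ).2]
    exact card_biUnion_le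

end Domatic

/-! ### The bound on the number of candidates. -/

namespace Domatic

open Finset

/-! ### Counting transversals -/

/-- The case of Hölder's inequality behind the Chung–Frankl–Graham–Shearer inequality. -/
theorem add_pow_le_prod {ι : Type*} [Fintype ι] [DecidableEq ι] {δ : ℕ} (hδ : δ ≠ 0)
    (p q r : ι → ℕ) (J : Finset ι) (hJ : δ ≤ J.card) (hr : ∀ j ∈ J, p j + q j = r j)
    (hp : ∀ j, p j ≤ r j) (hq : ∀ j, q j ≤ r j) {a b : ℕ} (ha : a ^ δ ≤ ∏ j, p j)
    (hb : b ^ δ ≤ ∏ j, q j) : (a + b) ^ δ ≤ ∏ j, r j := by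
  -- A vanishing `r j` forces `a = b = 0`; otherwise division by the `r j` is possible.
  by_cases h0 : ∃ j, r j = 0
  · obtain ⟨j, hj⟩ := h0
    have hpj : p j = 0 := by have := hp j; omega
    have hqj : q j = 0 := by have := hq j; omega
    rw [prod_eq_zero (mem_univ j) hpj, Nat.le_zero] at ha
    rw [prod_eq_zero (mem_univ j) hqj, Nat.le_zero] at hb
    simp [eq_zero_of_pow_eq_zero ha, eq_zero_of_pow_eq_zero hb, hδ]
  push Not at h0
  have hpos : ∀ j, (0 : ℝ) < r j := fun j => by exact_mod_cast Nat.pos_of_ne_zero (h0 j)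
  -- Exactly `δ` indices are kept, so that the weights `1 / δ` below sum to `1`.
  obtain ⟨J', hJ', hcard⟩ := exists_subset_card_eq hJ
  have hδ' : (0 : ℝ) < δ := by exact_mod_cast Nat.pos_of_ne_zero hδ
  set R : ℝ := ∏ j, (r j : ℝ) with hR
  have hRpos : 0 < R := prod_pos fun j _ => hpos j
  set ρ : ℝ := R ^ (1 / (δ : ℝ)) with hρ
  have hρpos : 0 < ρ := Real.rpow_pos_of_pos hRpos _
  have hρδ : ρ ^ δ = R := by
    rw [hρ, ← Real.rpow_natCast, ← Real.rpow_mul hRpos.le, one_div_mul_cancel hδ'.ne',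
      Real.rpow_one]
  -- The ratios outside `J'` are at most `1` and are dropped; AM–GM handles the rest. Adding the
  -- cases `(p, a)` and `(q, b)` leaves `ρ`, since the ratios sum to `1` on `J'`.
  have key : ∀ (p : ι → ℕ) (a : ℕ), (∀ j, p j ≤ r j) → a ^ δ ≤ ∏ j, p j →
      (a : ℝ) ≤ ρ * ∑ j ∈ J', (1 / (δ : ℝ)) * (p j / r j) := by
    intro p a hp ha
    have hz : ∀ j, (0 : ℝ) ≤ p j / r j := fun j => by positivity
    have h1 : ((a : ℝ) / ρ) ^ δ ≤ ∏ j, ((p j : ℝ) / r j) := by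
      rw [div_pow, hρδ, prod_div_distrib]
      gcongr
      exact_mod_cast ha
    have h2 : ∏ j, ((p j : ℝ) / r j) ≤ ∏ j ∈ J', ((p j : ℝ) / r j) := by
      rw [← prod_mul_prod_compl J']
      refine mul_le_of_le_one_right (prod_nonneg fun j _ => hz j) (prod_le_one (fun j _ => hz j)
        fun j _ => ?_)
      rw [div_le_one (hpos j)]
      exact_mod_cast hp j
    have h3 : ∏ j ∈ J', ((p j : ℝ) / r j) ^ (1 / (δ : ℝ)) ≤
        ∑ j ∈ J', (1 / (δ : ℝ)) * ((p j : ℝ) / r j) := by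
      refine Real.geom_mean_le_arith_mean_weighted J' (fun _ => 1 / (δ : ℝ)) _
        (fun _ _ => by positivity) ?_ fun j _ => hz j
      rw [sum_const, hcard, nsmul_eq_mul, mul_one_div_cancel hδ'.ne']
    have h4 : (a : ℝ) / ρ ≤ ∏ j ∈ J', ((p j : ℝ) / r j) ^ (1 / (δ : ℝ)) := by
      rw [Real.finsetProd_rpow _ _ fun j _ => hz j]
      have := Real.rpow_le_rpow (by positivity) (h1.trans h2) (z := 1 / (δ : ℝ)) (by positivity)
      rwa [← Real.rpow_natCast, ← Real.rpow_mul (by positivity), mul_one_div_cancel hδ'.ne',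
        Real.rpow_one] at this
    have := h4.trans h3
    rwa [div_le_iff₀ hρpos, mul_comm] at this
  have h := add_le_add (key p a hp ha) (key q b hq hb)
  rw [← mul_add, ← sum_add_distrib, sum_congr rfl (g := fun _ => 1 / (δ : ℝ)), sum_const, hcard,
    nsmul_eq_mul, mul_one_div_cancel hδ'.ne', mul_one] at h
  · have h' : ((a + b : ℕ) : ℝ) ^ δ ≤ R := by
      rw [← hρδ]
      push_cast
      gcongr
    rw [hR] at h'
    exact_mod_cast h'
  · intro j hj
    rw [← mul_add, ← add_div, ← Nat.cast_add, hr j (hJ' hj), div_self (hpos j).ne', mul_one]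

/-- The Chung–Frankl–Graham–Shearer inequality. -/
theorem card_pow_le_prod_card_image_inter {α ι : Type*} [DecidableEq α] [Fintype ι]
    [DecidableEq ι] {δ : ℕ} (hδ : δ ≠ 0) (A : ι → Finset α) (U : Finset α)
    (hA : ∀ v ∈ U, δ ≤ (univ.filter fun j => v ∈ A j).card) (F : Finset (Finset α))
    (hF : ∀ S ∈ F, S ⊆ U) : F.card ^ δ ≤ ∏ j, (F.image (· ∩ A j)).card := by
  induction U using Finset.induction_on generalizing F with
  | empty =>
    rcases F.eq_empty_or_nonempty with rfl | hne
    · simp [hδ]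
    · have h1 : F.card ≤ 1 := card_le_one.2 fun S hS T hT => by
        rw [subset_empty.1 (hF S hS), subset_empty.1 (hF T hT)]
      calc F.card ^ δ ≤ 1 := Nat.pow_le_one_iff hδ |>.2 h1
        _ ≤ _ := Nat.one_le_iff_ne_zero.2 <| prod_ne_zero_iff.2 fun j _ =>
          card_ne_zero.2 (hne.image _)
  | insert v U hv ih =>
    have hA' : ∀ u ∈ U, δ ≤ (univ.filter fun j => u ∈ A j).card :=
      fun u hu => hA u (mem_insert_of_mem hu)
    have i1 := ih hA' (F.memberSubfamily v) fun S hS => by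
      rw [mem_memberSubfamily] at hS
      exact (subset_insert_iff_of_notMem hS.2).1 ((subset_insert v S).trans (hF _ hS.1))
    have i0 := ih hA' (F.nonMemberSubfamily v) fun S hS => by
      rw [mem_nonMemberSubfamily] at hS
      exact (subset_insert_iff_of_notMem hS.2).1 (hF _ hS.1)
    -- Split `F` according to membership of `v`. If `v ∈ A j`, the traces on `A j` split
    -- accordingly; for every `j` each half has at most as many traces as `F`.
    rw [← card_memberSubfamily_add_card_nonMemberSubfamily v F]
    refine add_pow_le_prod hδ _ _ _ (univ.filter fun j => v ∈ A j) (hA v (mem_insert_self v U))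
      ?_ ?_ ?_ i1 i0
    · intro j hj
      have hvj := (mem_filter.1 hj).2
      rw [← card_memberSubfamily_add_card_nonMemberSubfamily v (F.image (· ∩ A j))]
      congr 2
      · ext S
        simp only [mem_image, mem_memberSubfamily]
        constructor
        · rintro ⟨T, ⟨hT, hvT⟩, rfl⟩
          exact ⟨⟨_, hT, by rw [insert_inter_of_mem hvj]⟩, fun h => hvT (mem_inter.1 h).1⟩
        · rintro ⟨⟨T, hT, h⟩, hvS⟩
          have hvT : v ∈ T := (mem_inter.1 (h ▸ mem_insert_self v S)).1
          refine ⟨T.erase v, ⟨by rwa [insert_erase hvT], notMem_erase v T⟩, ?_⟩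
          rw [erase_inter, h, erase_insert hvS]
      · ext S
        simp only [mem_image, mem_nonMemberSubfamily]
        constructor
        · rintro ⟨T, ⟨hT, hvT⟩, rfl⟩
          exact ⟨⟨_, hT, rfl⟩, fun h => hvT (mem_inter.1 h).1⟩
        · rintro ⟨⟨T, hT, rfl⟩, hvS⟩
          exact ⟨T, ⟨hT, fun h => hvS (mem_inter.2 ⟨h, hvj⟩)⟩, rfl⟩
    · intro j
      by_cases hvj : v ∈ A j
      · refine card_le_card_of_injOn (insert v) ?_ ?_
        · intro S hS
          obtain ⟨T, hT, rfl⟩ := mem_image.1 hS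
          rw [mem_memberSubfamily] at hT
          exact mem_image.2 ⟨_, hT.1, by rw [insert_inter_of_mem hvj]⟩
        · intro S hS S' hS' h
          obtain ⟨T, hT, rfl⟩ := mem_image.1 hS
          obtain ⟨T', hT', rfl⟩ := mem_image.1 hS'
          rw [mem_memberSubfamily] at hT hT'
          have h1 : v ∉ T ∩ A j := fun h => hT.2 (mem_inter.1 h).1
          have h2 : v ∉ T' ∩ A j := fun h => hT'.2 (mem_inter.1 h).1
          rw [← erase_insert h1, ← erase_insert h2]
          exact congrArg (fun S => erase S v) h
      · refine card_le_card fun S hS => ?_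
        obtain ⟨T, hT, rfl⟩ := mem_image.1 hS
        rw [mem_memberSubfamily] at hT
        exact mem_image.2 ⟨_, hT.1, by rw [insert_inter_of_notMem hvj]⟩
    · intro j
      exact card_le_card (image_subset_image (filter_subset _ _))

theorem card_fin_filter_lt {Δ k : ℕ} (hk : k ≤ Δ) :
    (univ.filter fun t : Fin Δ => (t : ℕ) < k).card = k := by
  rw [card_filter, Fin.sum_univ_eq_sum_range (fun t => if t < k then 1 else 0) Δ, ← card_filter]
  rw [show (range Δ).filter (· < k) = range k by ext t; simp; omega, card_range]

/-- The Chung–Frankl–Graham–Shearer inequality with the traces on the sets `nb v`; grouping all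
factors that belong to one `v` gives at most `2 ^ (Δ + 1) - 2`. -/
theorem card_pow_le_of_splits {nb : ℕ → Finset ℕ} {n Δ i : ℕ} (hΔ : 1 ≤ Δ) (hi : i ≤ n)
    (hself : ∀ v < n, v ∈ nb v) (hsub : ∀ v < n, nb v ⊆ range n)
    (hsymm : ∀ u < n, ∀ v < n, u ∈ nb v → v ∈ nb u) (hcard : ∀ v < n, (nb v).card ≤ Δ + 1)
    (F : Finset (Finset ℕ)) (hF : ∀ S ∈ F, S ⊆ range i ∧ Splits nb n i S) :
    F.card ^ (Δ + 1) ≤ (2 ^ (Δ + 1) - 2) ^ n := by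
  -- A vertex `v` with a small `nb v` gets `Δ + 1 - |nb v|` extra copies of `{v}` to be covered `Δ +
  -- 1` times; `Δ` slots suffice because `nb v` is nonempty. Unused slots are empty and contribute a
  -- factor `1`.
  let A : Fin n × Option (Fin Δ) → Finset ℕ := fun a => match a with
    | (v, none) => nb v
    | (v, some t) => if (t : ℕ) < Δ + 1 - (nb v).card then {(v : ℕ)} else ∅
  have hpos : ∀ v < n, 1 ≤ (nb v).card := fun v hv => card_pos.2 ⟨v, hself v hv⟩
  have hcount : ∀ v < n, (univ.filter fun t : Fin Δ => (t : ℕ) < Δ + 1 - (nb v).card).card =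
      Δ + 1 - (nb v).card := fun v hv => card_fin_filter_lt (by have := hpos v hv; omega)
  have hA : ∀ u ∈ range i, Δ + 1 ≤ (univ.filter fun a => u ∈ A a).card := by
    intro u hu
    have hu : u < n := (mem_range.1 hu).trans_le hi
    rw [card_filter, Fintype.sum_prod_type]
    simp only [Fintype.sum_option]
    rw [sum_add_distrib]
    -- By symmetry, the `v` with `u ∈ nb v` are the elements of `nb u`.
    have h1 : ∑ v : Fin n, (if u ∈ A (v, none) then 1 else 0) = (nb u).card := by
      change ∑ v : Fin n, (if u ∈ nb v then 1 else 0) = _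
      rw [Fin.sum_univ_eq_sum_range (fun v => if u ∈ nb v then 1 else 0) n, ← card_filter]
      congr 1
      ext v
      rw [mem_filter, mem_range]
      exact ⟨fun h => hsymm u hu v h.1 h.2, fun h =>
        ⟨mem_range.1 (hsub u hu h), hsymm v (mem_range.1 (hsub u hu h)) u hu h⟩⟩
    have h2 : Δ + 1 - (nb u).card ≤
        ∑ v : Fin n, ∑ t : Fin Δ, (if u ∈ A (v, some t) then 1 else 0) := by
      refine le_trans (le_of_eq ?_) (single_le_sum (f := fun v : Fin n =>
        ∑ t : Fin Δ, (if u ∈ A (v, some t) then 1 else 0)) (fun _ _ => Nat.zero_le _)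
        (mem_univ ⟨u, hu⟩))
      rw [← hcount u hu, card_filter]
      refine sum_congr rfl fun t _ => ?_
      simp only [A]
      split_ifs <;> simp_all
    have := hcard u hu
    omega
  refine (card_pow_le_prod_card_image_inter (Nat.succ_ne_zero Δ) A (range i) hA F
    fun S hS => (hF S hS).1).trans ?_
  rw [Fintype.prod_prod_type]
  simp only [Fintype.prod_option]
  calc _ ≤ ∏ _v : Fin n, (2 ^ (Δ + 1) - 2) := ?_
    _ = _ := by rw [prod_const, card_univ, Fintype.card_fin]
  refine prod_le_prod' fun v _ => ?_
  have hv := v.2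
  have hc := hcard v hv
  have hp := hpos v hv
  obtain ⟨c, hcc⟩ : ∃ c, (nb v).card = c + 1 := ⟨(nb v).card - 1, by omega⟩
  obtain ⟨e, rfl⟩ : ∃ e, Δ = c + e := ⟨Δ - c, by omega⟩
  have h1 : ∏ t : Fin (c + e), (F.image (· ∩ A (v, some t))).card ≤ 2 ^ e := by
    calc _ ≤ ∏ t : Fin (c + e), (if (t : ℕ) < c + e + 1 - (nb v).card then 2 else 1) := by
          refine prod_le_prod' fun t _ => ?_
          simp only [A]
          split_ifs
          · calc _ ≤ ({(v : ℕ)} : Finset ℕ).powerset.card := card_le_card fun T hT => by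
                  obtain ⟨S, -, rfl⟩ := mem_image.1 hT
                  exact mem_powerset.2 inter_subset_right
              _ = 2 := by simp
          · calc _ ≤ ({∅} : Finset (Finset ℕ)).card := card_le_card fun T hT => by
                  obtain ⟨S, -, rfl⟩ := mem_image.1 hT
                  simp
              _ = 1 := by simp
      _ = 2 ^ e := by
          rw [prod_ite, prod_const, prod_const_one, mul_one, hcount v hv, hcc]
          congr 1
          omega
  -- If `nb v` lies below `i`, the traces `∅` and `nb v` are excluded; if not, some element of `nb
  -- v` is undecided and absent from all traces.
  have h2 : (F.image (· ∩ A (v, none))).card ≤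
      if nb v ⊆ range i then 2 ^ (c + 1) - 2 else 2 ^ c := by
    simp only [A]
    split_ifs with hs
    · have hne : (∅ : Finset ℕ) ≠ nb v := fun h => by simp [← h] at hcc
      calc _ ≤ (((nb v).powerset.erase (nb v)).erase ∅).card := card_le_card fun T hT => by
            obtain ⟨S, hS, rfl⟩ := mem_image.1 hT
            obtain ⟨⟨u, hu⟩, k2⟩ := (hF S hS).2 v hv hs
            rw [mem_erase, mem_erase, mem_powerset]
            refine ⟨fun h => ?_, fun h => k2 (inter_eq_right.1 h), inter_subset_right⟩
            rw [inter_comm] at hu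
            simp [h] at hu
        _ = _ := by
            rw [card_erase_of_mem (mem_erase.2 ⟨hne, empty_mem_powerset _⟩),
              card_erase_of_mem (mem_powerset_self _), card_powerset, hcc]
            rfl
    · obtain ⟨u, hu, hui⟩ := not_subset.1 hs
      calc _ ≤ ((nb v).erase u).powerset.card := card_le_card fun T hT => by
            obtain ⟨S, hS, rfl⟩ := mem_image.1 hT
            rw [mem_powerset]
            exact subset_erase.2 ⟨inter_subset_right, fun h =>
              hui ((hF S hS).1 (mem_inter.1 h).1)⟩
        _ = _ := by rw [card_powerset, card_erase_of_mem hu, hcc]; rfl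
  refine (Nat.mul_le_mul h2 h1).trans ?_
  have he : 1 ≤ 2 ^ e := Nat.one_le_two_pow
  -- This needs `Δ ≥ 1`, and is what makes `2 ^ Δ ≤ 2 ^ (Δ + 1) - 2` in the undecided case.
  have hce : 2 ≤ 2 ^ (c + e) := Nat.le_self_pow (by omega) 2
  have hcs : 2 ^ (c + e + 1) = 2 ^ (c + 1) * 2 ^ e := by rw [← pow_add]; congr 1; omega
  split_ifs
  · rw [Nat.sub_mul, ← hcs]
    omega
  · rw [← pow_add, pow_succ]
    omega

theorem card_le_rpow {a n Δ : ℕ} (h : a ^ (Δ + 1) ≤ (2 ^ (Δ + 1) - 2) ^ n) :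
    (a : ℝ) ≤ ((2 : ℝ) ^ (Δ + 1) - 2) ^ ((n : ℝ) / ((Δ : ℝ) + 1)) := by
  have h2 : 2 ≤ 2 ^ (Δ + 1) := Nat.le_self_pow (Nat.succ_ne_zero Δ) 2
  have hb : (0 : ℝ) ≤ (2 : ℝ) ^ (Δ + 1) - 2 := by
    have : (2 : ℝ) ≤ (2 : ℝ) ^ (Δ + 1) := by exact_mod_cast h2
    linarith
  have h' : (a : ℝ) ^ (Δ + 1) ≤ ((2 : ℝ) ^ (Δ + 1) - 2) ^ n := by
    have : ((a ^ (Δ + 1) : ℕ) : ℝ) ≤ (((2 ^ (Δ + 1) - 2) ^ n : ℕ) : ℝ) := by exact_mod_cast h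
    rw [Nat.cast_pow, Nat.cast_pow, Nat.cast_sub h2] at this
    exact_mod_cast this
  have := Real.rpow_le_rpow (by positivity) h' (z := 1 / ((Δ : ℝ) + 1)) (by positivity)
  rw [← Real.rpow_natCast, ← Real.rpow_natCast, ← Real.rpow_mul (by positivity),
    ← Real.rpow_mul hb] at this
  push_cast at this
  rwa [mul_one_div_cancel (by positivity), Real.rpow_one, mul_one_div] at this

end Domatic

/-! ### Listing the candidates on the machine. -/

namespace Domatic

open Finset RAM RAM.Pr RAM.Ex

/-! ### Enumeration of the family on the machine -/

theorem lt_two_pow_of_le {a e w : ℕ} (h : a < 2 ^ e) (he : e ≤ w) : a < 2 ^ w :=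
  h.trans_le (Nat.pow_le_pow_right (by norm_num) he)

/-- The last binary digit of a value. -/
def lowBit (e : Ex) : Ex := .sub e (.mul (.lit 2) (.div e (.lit 2)))

@[simp] theorem eval_lowBit (x : List ℕ) (s : State) (e : Ex) :
    (lowBit e).eval x s = e.eval x s % 2 := by
  simp only [lowBit, Ex.eval]
  omega

/-- Entry `(v, u)` of the adjacency matrix with ones on the diagonal. -/
def closedEntry : Ex :=
  .add (.inp (.add (.lit 1) (.add (.mul (.var .v) (.var .n)) (.var .u))))
    (.sub (.lit 1) (.add (.sub (.var .u) (.var .v)) (.sub (.var .v) (.var .u))))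

/-- The input `x` describes the sets `nb v`, `v < n`. -/
structure Describes (x : List ℕ) (n : ℕ) (nb : ℕ → Finset ℕ) : Prop where
  size : x.getD 0 0 = n
  entry : ∀ v < n, ∀ u < n, x.getD (1 + (v * n + u)) 0 + (1 - ((u - v) + (v - u))) =
    if u ∈ nb v then 1 else 0
  self : ∀ v < n, v ∈ nb v
  sub : ∀ v < n, nb v ⊆ range n

/-- Scan row `v` of the closed adjacency matrix against the candidate. -/
def checkRow : Pr :=
  .seq (assign .adj closedEntry) <|
  .seq (assign .inside (.add (.var .inside) (.mul (.var .adj) (lowBit (.var .rest))))) <|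
  .seq (assign .outside
    (.add (.var .outside) (.mul (.var .adj) (.sub (.lit 1) (lowBit (.var .rest)))))) <|
  .seq (assign .late (.add (.var .late) (.mul (.var .adj) (.sub (.var .u) (.var .i))))) <|
  assign .rest (.div (.var .rest) (.lit 2))

/-- Test whether the candidate is ruled out by a set contained in `{0, …, i}`. -/
def check : Pr :=
  .seq (assign .ok (.lit 1)) <|
  forTo .v (.var .n) <|
    .seq (assign .inside (.lit 0)) <|
    .seq (assign .outside (.lit 0)) <|
    .seq (assign .late (.lit 0)) <|
    .seq (assign .rest (.var .cand)) <|
    .seq (forTo .u (.var .n) checkRow) <|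
    .ite (.add (.var .late) (.mul (.var .inside) (.var .outside))) .skip (assign .ok (.lit 0))

section

variable {x : List ℕ} {n w : ℕ} {nb : ℕ → Finset ℕ}

/-- The three sums are the final contents of `late`, `inside` and `outside`. The first vanishes iff
no element of `A` exceeds `i`, by truncation of `u - i`; the other two count the elements of `A` in
and out of `Y`. -/
theorem row_test_iff {A Y : Finset ℕ} {i : ℕ} (hA : A ⊆ range n) :
    (∑ u ∈ range n, (if u ∈ A then 1 else 0) * (u - i)) +
      (∑ u ∈ range n, (if u ∈ A then 1 else 0) * (mask Y / 2 ^ u % 2)) *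
      (∑ u ∈ range n, (if u ∈ A then 1 else 0) * (1 - mask Y / 2 ^ u % 2)) ≠ 0 ↔
    (A ⊆ range (i + 1) → (A ∩ Y).Nonempty ∧ ¬ A ⊆ Y) := by
  have h1 : (∑ u ∈ range n, (if u ∈ A then 1 else 0) * (u - i)) = 0 ↔ A ⊆ range (i + 1) := by
    rw [sum_eq_zero_iff]
    constructor
    · intro h u hu
      have := h u (hA hu)
      simp only [hu, if_true, one_mul] at this
      rw [mem_range]
      omega
    · intro h u _
      by_cases hu : u ∈ A
      · have := mem_range.1 (h hu)
        simp [hu]; omega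
      · simp [hu]
  have h2 : (∑ u ∈ range n, (if u ∈ A then 1 else 0) * (mask Y / 2 ^ u % 2)) = 0 ↔
      ¬ (A ∩ Y).Nonempty := by
    rw [sum_eq_zero_iff, not_nonempty_iff_eq_empty, eq_empty_iff_forall_notMem]
    simp only [mask_div_mod]
    constructor
    · intro h u hu
      rw [mem_inter] at hu
      simpa [hu.1, hu.2] using h u (hA hu.1)
    · intro h u _
      have := h u
      rw [mem_inter, not_and] at this
      by_cases hu : u ∈ A
      · simp [this hu]
      · simp [hu]
  have h3 : (∑ u ∈ range n, (if u ∈ A then 1 else 0) * (1 - mask Y / 2 ^ u % 2)) = 0 ↔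
      A ⊆ Y := by
    rw [sum_eq_zero_iff]
    simp only [mask_div_mod]
    constructor
    · intro h u hu
      by_contra hY
      simpa [hu, hY] using h u (hA hu)
    · intro h u _
      by_cases hu : u ∈ A
      · simp [h hu]
      · simp [hu]
  rw [Ne, Nat.add_eq_zero_iff, mul_eq_zero, h1, h2, h3]
  tauto

theorem sum_indicator_mul_le (A : Finset ℕ) (c : ℕ → ℕ) {k b : ℕ} (hc : ∀ u < k, c u ≤ b) :
    ∑ u ∈ range k, (if u ∈ A then 1 else 0) * c u ≤ k * b := by
  calc _ ≤ ∑ _u ∈ range k, b := sum_le_sum fun u hu => by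
        have := hc u (mem_range.1 hu)
        split_ifs <;> omega
    _ = _ := by simp

theorem achieves_checkRow (hx : Describes x n nb) (hw : 2 * n + 2 ≤ w) {s : State} {v i : ℕ}
    {Y : Finset ℕ} (hY : Y ⊆ range n) (hv : v < n) (hsn : s .n 0 = n) (hsv : s .v 0 = v)
    (hsi : s .i 0 = i) (h0 : s .inside 0 = 0) (h1 : s .outside 0 = 0) (h2 : s .late 0 = 0)
    (h3 : s .rest 0 = mask Y) :
    Achieves x w (forTo .u (.var .n) checkRow) s (n * 7 + 2) (fun s' =>
      s' .late 0 = (∑ u ∈ range n, (if u ∈ nb v then 1 else 0) * (u - i)) ∧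
      s' .inside 0 = (∑ u ∈ range n, (if u ∈ nb v then 1 else 0) * (mask Y / 2 ^ u % 2)) ∧
      s' .outside 0 = (∑ u ∈ range n, (if u ∈ nb v then 1 else 0) * (1 - mask Y / 2 ^ u % 2)) ∧
      ∀ t ∉ Tag.u :: checkRow.writes, s' t = s t) := by
  have hnw : n < 2 ^ w := lt_two_pow_of_le Nat.lt_two_pow_self (by omega)
  have hnn : n * n < 2 ^ w := by
    refine lt_two_pow_of_le (e := n + n) ?_ (by omega)
    rw [pow_add]
    exact Nat.mul_lt_mul'' Nat.lt_two_pow_self Nat.lt_two_pow_self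
  have hYw : mask Y < 2 ^ w := lt_two_pow_of_le (mask_lt hY) (by omega)
  have h2w : 1 < 2 ^ w := lt_two_pow_of_le (e := 1) (by norm_num) (by omega)
  refine Achieves.mono (Achieves.forTo (N := n) (T := 5) (fun k s' =>
      s' .late 0 = (∑ u ∈ range k, (if u ∈ nb v then 1 else 0) * (u - i)) ∧
      s' .inside 0 = (∑ u ∈ range k, (if u ∈ nb v then 1 else 0) * (mask Y / 2 ^ u % 2)) ∧
      s' .outside 0 = (∑ u ∈ range k, (if u ∈ nb v then 1 else 0) * (1 - mask Y / 2 ^ u % 2)) ∧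
      s' .rest 0 = mask Y / 2 ^ k) (by decide) (by decide) (by simpa using hsn) hnw ?_ ?_) le_rfl
      fun s' h => ⟨h.1.1, h.1.2.1, h.1.2.2.1, h.2⟩
  · simp [State.upd_apply, h0, h1, h2, h3]
  · rintro u hu s' ⟨k1, k2, k3, k4⟩ hsu hf
    have fn := congrFun (hf .n (by decide)) 0
    have fv := congrFun (hf .v (by decide)) 0
    have fi := congrFun (hf .i (by decide)) 0
    rw [hsn] at fn
    rw [hsv] at fv
    rw [hsi] at fi
    have b1 := sum_indicator_mul_le (nb v) (fun u => u - i) (k := u + 1) (b := n)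
      (fun u _ => by omega)
    have b2 := sum_indicator_mul_le (nb v) (fun u => mask Y / 2 ^ u % 2) (k := u + 1) (b := 1)
      (fun u _ => by omega)
    have b3 := sum_indicator_mul_le (nb v) (fun u => 1 - mask Y / 2 ^ u % 2) (k := u + 1) (b := 1)
      (fun u _ => by omega)
    have b4 : (u + 1) * n ≤ n * n := Nat.mul_le_mul_right _ hu
    rw [sum_range_succ] at b1 b2 b3
    have e1 : closedEntry.eval x s' = if u ∈ nb v then 1 else 0 := by
      simpa [closedEntry, Ex.eval, fn, fv, hsu] using hx.entry v hv u hu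
    have e2 : mask Y / 2 ^ (u + 1) = mask Y / 2 ^ u / 2 := by
      rw [pow_succ, Nat.div_div_eq_div_mul]
    have b5 : mask Y / 2 ^ u / 2 < 2 ^ w :=
      ((Nat.div_le_self _ _).trans (Nat.div_le_self _ _)).trans_lt hYw
    refine Achieves.seq (T := 1) (T' := 4) (.assign (by rw [e1]; split_ifs <;> omega) ?_)
    rw [e1]
    refine Achieves.seq (T := 1) (T' := 3) (.assign ?_ ?_)
    · simp [Ex.eval, State.upd_apply, k2, k4]; simp at b2; omega
    refine Achieves.seq (T := 1) (T' := 2) (.assign ?_ ?_)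
    · simp [Ex.eval, State.upd_apply, k3, k4]; simp at b3; omega
    refine Achieves.seq (T := 1) (T' := 1) (.assign ?_ ?_)
    · simp [Ex.eval, State.upd_apply, k1, hsu, fi]; simp at b1; omega
    refine .assign ?_ ?_
    · simpa [Ex.eval, State.upd_apply, k4] using b5
    · intro _ _
      simp only [sum_range_succ]
      simp [Ex.eval, State.upd_apply, k1, k2, k3, k4, hsu, fi, e2]

theorem achieves_check (hx : Describes x n nb) (hw : 2 * n + 2 ≤ w) {s : State} {i : ℕ}
    {Y : Finset ℕ} (hY : Y ⊆ range n) (hsn : s .n 0 = n) (hsi : s .i 0 = i)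
    (hs : s .cand 0 = mask Y) :
    Achieves x w check s (n * (n * 7 + 10) + 3) (fun s' =>
      s' .ok 0 = (if Splits nb n (i + 1) Y then 1 else 0) ∧ ∀ t ∉ check.writes, s' t = s t) := by
  have hnw : n < 2 ^ w := lt_two_pow_of_le Nat.lt_two_pow_self (by omega)
  have hYw : mask Y < 2 ^ w := lt_two_pow_of_le (mask_lt hY) (by omega)
  have h2w : 1 < 2 ^ w := lt_two_pow_of_le (e := 1) (by norm_num) (by omega)
  let R : ℕ → Prop := fun v => nb v ⊆ range (i + 1) → (nb v ∩ Y).Nonempty ∧ ¬ nb v ⊆ Y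
  refine Achieves.mono (T := 1 + (n * ((n * 7 + 8) + 2) + 2)) (Achieves.with_frame
    (.seq (.assign (by simpa [Ex.eval] using h2w) (.forTo (N := n) (fun k s' =>
      s' .ok 0 = if ∀ v < k, R v then 1 else 0) (by decide) (by decide)
      (by simpa [State.upd_apply] using hsn) hnw ?_ ?_)))) (by ring_nf; omega)
      fun s' h => ⟨h.1.1, h.2⟩
  · simp [State.upd_apply, Ex.eval]
  · intro v hv s' hok hsv hf
    have fn : s' .n 0 = n := by rw [hf .n (by decide)]; simpa [State.upd_apply] using hsn
    have fi : s' .i 0 = i := by rw [hf .i (by decide)]; simpa [State.upd_apply] using hsi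
    have fc : s' .cand 0 = mask Y := by rw [hf .cand (by decide)]; simpa [State.upd_apply] using hs
    refine Achieves.mono (T := 1 + (1 + (1 + (1 + ((n * 7 + 2) + 2))))) ?_ (by omega) fun _ h => h
    refine .seq (.assign (by simp [Ex.eval]) ?_)
    refine .seq (.assign (by simp [Ex.eval]) ?_)
    refine .seq (.assign (by simp [Ex.eval]) ?_)
    refine .seq (.assign (by simpa [State.upd_apply, fc] using hYw) ?_)
    refine .seq ((achieves_checkRow hx hw hY hv (i := i) ?_ ?_ ?_ ?_ ?_ ?_ ?_).mono le_rfl ?_)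
    iterate 7 simp [State.upd_apply, Ex.eval, fn, fi, fc, hsv]
    rintro s'' ⟨k1, k2, k3, k4⟩
    have fok : s'' .ok 0 = s' .ok 0 := by rw [k4 .ok (by decide)]; simp [State.upd_apply]
    have hiff := row_test_iff (Y := Y) (i := i) (hx.sub v hv)
    rw [← k1, ← k2, ← k3] at hiff
    refine .ite (T := 1) (fun he => .skip fun _ _ => ?_) fun he => .assign (by simp [Ex.eval])
      fun _ _ => ?_
    · have : R v := hiff.1 (by simpa [Ex.eval] using he)
      simp only [State.upd_apply, reduceCtorEq, if_false, fok, hok, 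
        Nat.lt_succ_iff_lt_or_eq, or_imp, forall_and, forall_eq, this, and_true]
    · have : ¬ R v := fun h => hiff.2 h (by simpa [Ex.eval] using he)
      have h' : ¬ ∀ u < v + 1, R u := fun h => this (h v (Nat.lt_succ_self v))
      rw [if_neg h']
      simp [State.upd_apply, Ex.eval]

/-! ### Lists of sets in memory -/

/-- The list `l` of sets is stored from position `a` on. -/
def Seg (s : State) (a : ℕ) (l : List (Finset ℕ)) : Prop :=
  ∀ j (h : j < l.length), s .list (a + j) = mask l[j]

theorem seg_append_singleton {s : State} {a : ℕ} {l : List (Finset ℕ)} {Y : Finset ℕ} :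
    Seg s a (l ++ [Y]) ↔ Seg s a l ∧ s .list (a + l.length) = mask Y := by
  constructor
  · refine fun h => ⟨fun j hj => ?_, ?_⟩
    · rw [h j (by simp; omega), List.getElem_append_left hj]
    · rw [h l.length (by simp)]
      simp
  · rintro ⟨h1, h2⟩ j hj
    rw [List.length_append, List.length_singleton, Nat.lt_succ_iff_lt_or_eq] at hj
    rcases hj with hj | rfl
    · rw [h1 j hj, List.getElem_append_left hj]
    · simpa using h2

/-- Append the value of `e` to the list if it passes the test. -/
def tryAppend (e : Ex) : Pr :=
  .seq (assign .cand e) <|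
  .seq check <|
  .ite (.var .ok)
    (.seq (set .list (.var .last) (.var .cand)) <| assign .last (.add (.var .last) (.lit 1))) .skip

/-- The clause on positions below `a` protects the previous layer, which is still being read while
the next one is written. -/
theorem achieves_tryAppend (hx : Describes x n nb) (hw : 2 * n + 2 ≤ w) {s : State} {i : ℕ}
    {Y : Finset ℕ} (hY : Y ⊆ range n) (hsn : s .n 0 = n) (hsi : s .i 0 = i) {e : Ex}
    (he : e.eval x s = mask Y) {a : ℕ} {l : List (Finset ℕ)} (hl : Seg s a l)
    (hlast : s .last 0 = a + l.length) (hlw : a + l.length + 1 < 2 ^ w) :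
    Achieves x w (tryAppend e) s (n * (n * 7 + 10) + 7) (fun s' =>
      Seg s' a (l ++ [Y].filter fun Y => Splits nb n (i + 1) Y) ∧
      s' .last 0 = a + (l ++ [Y].filter fun Y => Splits nb n (i + 1) Y).length ∧
      (∀ b < a, s' .list b = s .list b) ∧
      ∀ t ∉ Tag.cand :: Tag.list :: Tag.last :: check.writes, s' t = s t) := by
  have hYw : mask Y < 2 ^ w := lt_two_pow_of_le (mask_lt hY) (by omega)
  refine Achieves.mono (T := 1 + (n * (n * 7 + 10) + 3 + (2 + 1))) ?_ (by omega) fun _ h => h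
  refine .seq (.assign (by rwa [he]) (.seq ((achieves_check hx hw hY (i := i) ?_ ?_ ?_).mono
    le_rfl ?_)))
  · simpa [State.upd_apply] using hsn
  · simpa [State.upd_apply] using hsi
  · simpa [State.upd_apply] using he
  rintro s' ⟨k1, k2⟩
  have fl : s' .list = s .list := by
    rw [k2 .list (by decide)]; exact State.upd_ne _ (by decide) _ _
  have fla : s' .last 0 = a + l.length := by
    rw [k2 .last (by decide), State.upd_ne _ (by decide), hlast]
  have fc : s' .cand 0 = mask Y := by rw [k2 .cand (by decide)]; simpa using he
  have ff : ∀ t ∉ Tag.cand :: Tag.list :: Tag.last :: check.writes, s' t = s t := fun t ht => by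
    rw [k2 t fun h => ht (by simp [h]), State.upd_ne _ fun h => ht (by simp [h])]
  have hl' : Seg s' a l := fun j hj => by rw [fl]; exact hl j hj
  refine .ite (fun hok => ?_) fun hok => ?_
  · have hS : Splits nb n (i + 1) Y := by
      by_contra h
      simp [k1, h] at hok
    refine .seq (T := 1) (T' := 1) (.set (by simpa [fc] using hYw) (.assign ?_ ?_))
    · simpa [State.upd_apply, Ex.eval, fla] using hlw
    · have hf : [Y].filter (fun Y => Splits nb n (i + 1) Y) = [Y] := by simp [hS]
      rw [hf, seg_append_singleton]
      refine ⟨⟨fun j hj => ?_, ?_⟩, ?_, fun b hb => ?_, fun t ht => ?_⟩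
      · simp [State.upd_apply, fla, hj.ne, hl' j hj]
      · simp [State.upd_apply, fla, fc]
      · simp [State.upd_apply, Ex.eval, fla, add_assoc]
      · have : b ≠ a + l.length := by omega
        simp [State.upd_apply, fla, this, fl]
      · rw [State.upd_ne _ fun h => ht (by simp [h]), State.upd_ne _ fun h => ht (by simp [h]),
          ff t ht]
  · have hS : ¬ Splits nb n (i + 1) Y := by
      intro h
      simp [k1, h] at hok
    refine (Achieves.skip ?_).mono (T' := 2) (by norm_num) fun _ h => h
    have hf : [Y].filter (fun Y => Splits nb n (i + 1) Y) = [] := by simp [hS]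
    rw [hf, List.append_nil]
    exact ⟨hl', fla, fun b _ => by rw [fl], ff⟩

/-- Enumerate the subsets of the vertex set that are not ruled out. -/
def enumerate : Pr :=
  .seq (set .list (.lit 0) (.lit 0)) <|
  .seq (assign .first (.lit 0)) <|
  .seq (assign .last (.lit 1)) <|
  .seq (assign .bit (.lit 1)) <|
  forTo .i (.var .n) <|
    .seq (assign .upto (.var .last)) <|
    .seq (forTo .j (.sub (.var .upto) (.var .first)) <|
      .seq (assign .cur (.get .list (.add (.var .first) (.var .j)))) <|
      .seq (tryAppend (.var .cur)) <|
      tryAppend (.add (.var .cur) (.var .bit))) <|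
    .seq (assign .first (.var .upto)) <|
    assign .bit (.add (.var .bit) (.var .bit))

/-- The list `l` is stored between the positions held by `first` and `last`. -/
def Stored (s : State) (l : List (Finset ℕ)) : Prop :=
  Seg s (s .first 0) l ∧ s .last 0 = s .first 0 + l.length

theorem children_eq (i : ℕ) (S : Finset ℕ) : children nb n i S =
    [S].filter (fun Y => Splits nb n (i + 1) Y) ++
      [insert i S].filter (fun Y => Splits nb n (i + 1) Y) := by
  rw [← List.filter_append]
  rfl

theorem length_flatMap_children_le (i : ℕ) (l : List (Finset ℕ)) :
    (l.flatMap (children nb n i)).length ≤ 2 * l.length := by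
  induction l with
  | nil => simp
  | cons S l ih =>
    have : (children nb n i S).length ≤ 2 := (List.length_filter_le _ _).trans (by simp)
    rw [List.flatMap_cons, List.length_append, List.length_cons]
    omega

theorem length_layer_le (i : ℕ) : (layer nb n i).length ≤ 2 ^ i := by
  induction i with
  | zero => simp [layer]
  | succ i ih =>
    rw [layer, pow_succ]
    have := length_flatMap_children_le (nb := nb) (n := n) i (layer nb n i)
    omega

theorem achieves_enumerate (hx : Describes x n nb) (hw : 2 * n + 2 ≤ w) {M : ℕ}
    (hM : ∀ i ≤ n, (layer nb n i).length ≤ M) {s : State} (hsn : s .n 0 = n) :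
    Achieves x w enumerate s (n * (M * (n * (n * 14 + 20) + 17) + 7) + 6) (fun s' =>
      Stored s' (layer nb n n) ∧ ∀ t ∉ enumerate.writes, s' t = s t) := by
  have hnb : ∀ v < n, (nb v).Nonempty := fun v hv => ⟨v, hx.self v hv⟩
  have hnw : n < 2 ^ w := lt_two_pow_of_le Nat.lt_two_pow_self (by omega)
  have h2w : 1 < 2 ^ w := lt_two_pow_of_le (e := 1) (by norm_num) (by omega)
  have hpw : ∀ k ≤ n, 2 ^ (k + 2) ≤ 2 ^ w := fun k hk =>
    Nat.pow_le_pow_right (by norm_num) (by omega)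
  refine Achieves.mono (T := 1 + (1 + (1 + (1 + (n * ((1 + ((M * ((n * (n * 14 + 20) + 15) + 2)
    + 2) + (1 + 1))) + 2) + 2))))) (Achieves.with_frame ?_) (by ring_nf; omega) fun _ h => h
  refine .seq (.set (by simp [Ex.eval]) ?_)
  refine .seq (.assign (by simp [Ex.eval]) ?_)
  refine .seq (.assign (by simpa [Ex.eval] using h2w) ?_)
  refine .seq (.assign (by simpa [Ex.eval] using h2w) ?_)
  -- Layers are stored one after another. Layer `j` has at most `2 ^ j` members, so `last` stays
  -- below `2 ^ (k + 1)` and fits into a word.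
  refine Achieves.mono (Achieves.forTo (N := n) (fun k s' => Stored s' (layer nb n k) ∧
    s' .bit 0 = 2 ^ k ∧ s' .last 0 < 2 ^ (k + 1)) (by decide) (by decide)
    (by simpa [State.upd_apply] using hsn) hnw ?_ ?_) le_rfl fun s' h => h.1.1
  · refine ⟨⟨fun j hj => ?_, ?_⟩, ?_, ?_⟩
    · simp only [layer, List.length_singleton, Nat.lt_one_iff] at hj
      subst hj
      simp [State.upd_apply, Ex.eval, layer]
    · simp [State.upd_apply, Ex.eval, layer]
    · simp [State.upd_apply, Ex.eval]
    · simp [State.upd_apply, Ex.eval]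
  intro i hi s₁ ⟨⟨hseg, hlast⟩, hbit, hlt⟩ hsi hf
  have fn : s₁ .n 0 = n := by
    rw [hf .n (by decide)]; simpa [State.upd_apply] using hsn
  generalize hl : layer nb n i = l at hseg hlast
  have hlM : l.length ≤ M := hl ▸ hM i hi.le
  have hmem : ∀ S ∈ l, S ⊆ range i := fun S hS => ((mem_layer hnb).1 (hl ▸ hS)).1
  have hpi := hpw i hi.le
  have hp1 : 2 ^ (i + 1) = 2 * 2 ^ i := by ring
  have hp2 : 2 ^ (i + 2) = 4 * 2 ^ i := by ring
  have hl2 : l.length ≤ 2 ^ i := hl ▸ length_layer_le i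
  refine .seq (.assign (by simp; omega) ?_)
  generalize hs₂ : s₁.upd .upto 0 ((Ex.var .last).eval x s₁) = s₂
  generalize ha : s₁ .first 0 = a at hseg hlast
  generalize hz : a + l.length = z at hlast
  have g1 : s₂ .upto 0 = z := by simp [← hs₂, hlast]
  have g2 : s₂ .first 0 = a := by simp [← hs₂, State.upd_apply, ha]
  have g3 : s₂ .last 0 = z := by simp [← hs₂, State.upd_apply, hlast]
  have g4 : s₂ .list = s₁ .list := by rw [← hs₂, State.upd_ne _ (by decide)]
  have g5 : s₂ .bit 0 = 2 ^ i := by simp [← hs₂, State.upd_apply, hbit]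
  have g6 : s₂ .n 0 = n := by simp [← hs₂, State.upd_apply, fn]
  have g7 : s₂ .i 0 = i := by simp [← hs₂, State.upd_apply, hsi]
  -- The position `z` is both the end of layer `i` and the start of layer `i + 1`, which grows by
  -- the children of the first `J` members.
  refine .seq (Achieves.mono (Achieves.forTo (N := l.length) (T := n * (n * 14 + 20) + 15)
    (fun J s' => Seg s' z ((l.take J).flatMap (children nb n i)) ∧
      s' .last 0 = z + ((l.take J).flatMap (children nb n i)).length ∧
      ∀ b < z, s' .list b = s₁ .list b) (by decide) (by decide)
    (by simp only [Ex.eval, Ex.eval_var, g1, g2]; omega) (by omega) ?_ ?_)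
    (by gcongr) ?_)
  · refine ⟨fun j hj => by simp at hj, by simp [State.upd_apply, g3], fun b _ => ?_⟩
    rw [State.upd_ne _ (by decide), g4]
  · intro J hJ s₃ ⟨k1, k2, k3⟩ hj hf₃
    have hlen := length_flatMap_children_le (nb := nb) (n := n) i (l.take J)
    rw [List.length_take_of_le hJ.le] at hlen
    have hS : l[J] ⊆ range i := hmem _ (List.getElem_mem hJ)
    have hSn : l[J] ⊆ range n := hS.trans (range_subset_range.2 hi.le)
    have hSi : i ∉ l[J] := fun h => by simpa using hS h
    have hcur : s₃ .list (a + J) = mask l[J] := by rw [k3 _ (by omega)]; exact hseg J hJ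
    have f1 : s₃ .first 0 = a := by rw [hf₃ .first (by decide), g2]
    have f2 : s₃ .bit 0 = 2 ^ i := by rw [hf₃ .bit (by decide), g5]
    have f3 : s₃ .n 0 = n := by rw [hf₃ .n (by decide), g6]
    have f4 : s₃ .i 0 = i := by rw [hf₃ .i (by decide), g7]
    have hzw : z < 2 ^ (i + 1) := by omega
    generalize hL : (l.take J).flatMap (children nb n i) = L at k1 k2 hlen
    refine Achieves.mono (T := 1 + ((n * (n * 7 + 10) + 7) + (n * (n * 7 + 10) + 7))) ?_
      (by ring_nf; omega) fun _ h => h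
    refine .seq (.assign ?_ ?_)
    · simp only [Ex.eval, Ex.eval_var, f1, hj, hcur]
      exact lt_two_pow_of_le (mask_lt hSn) (by omega)
    refine .seq ((achieves_tryAppend hx hw (i := i) hSn ?_ ?_ ?_ (a := z) (l := L) ?_ ?_ ?_).mono
      le_rfl ?_)
    · simpa [State.upd_apply] using f3
    · simpa [State.upd_apply] using f4
    · simp [Ex.eval, f1, hj, hcur]
    · intro j hj'
      rw [State.upd_ne _ (by decide)]
      exact k1 j hj'
    · simpa [State.upd_apply] using k2
    · omega
    rintro s₄ ⟨q1, q2, q3, q4⟩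
    have hlen' : ([l[J]].filter fun Y => Splits nb n (i + 1) Y).length ≤ 1 :=
      (List.length_filter_le _ _).trans (by simp)
    refine (achieves_tryAppend hx hw (i := i) (Y := insert i l[J]) ?_ ?_ ?_ ?_ (a := z) q1 q2
      ?_).mono le_rfl ?_
    · exact insert_subset (by simpa using hi) hSn
    · rw [q4 .n (by decide), State.upd_ne _ (by decide), f3]
    · rw [q4 .i (by decide), State.upd_ne _ (by decide), f4]
    · simp only [Ex.eval, Ex.eval_var]
      rw [q4 .cur (by decide), q4 .bit (by decide), mask_insert hSi]
      simp [State.upd_apply, Ex.eval, f1, hj, hcur, f2]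
    · rw [List.length_append]
      omega
    rintro s₅ ⟨r1, r2, r3, r4⟩ - -
    have e : (l.take (J + 1)).flatMap (children nb n i) =
        L ++ [l[J]].filter (fun Y => Splits nb n (i + 1) Y) ++
          [insert i l[J]].filter (fun Y => Splits nb n (i + 1) Y) := by
      rw [List.take_add_one, List.getElem?_eq_getElem hJ, List.flatMap_append, hL,
        List.append_assoc, ← children_eq]
      simp
    rw [e]
    refine ⟨fun j hj' => ?_, ?_, fun b hb => ?_⟩
    · rw [State.upd_ne _ (by decide)]
      exact r1 j hj'
    · rw [State.upd_ne _ (by decide), r2]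
    · rw [State.upd_ne _ (by decide), r3 b hb, q3 b hb, State.upd_ne _ (by decide), k3 b hb]
  · rintro s₃ ⟨⟨k1, k2, -⟩, hf₃⟩
    have e : l.flatMap (children nb n i) = layer nb n (i + 1) := by rw [layer, hl]
    rw [List.take_length, e] at k1 k2
    have f1 : s₃ .upto 0 = z := by rw [hf₃ .upto (by decide), g1]
    have f2 : s₃ .bit 0 = 2 ^ i := by rw [hf₃ .bit (by decide), g5]
    have hlen := length_layer_le (nb := nb) (n := n) (i + 1)
    refine .seq (.assign (by simp [f1]; omega) (.assign ?_ ?_))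
    · simp [State.upd_apply, Ex.eval, f2]; omega
    · rintro - -
      refine ⟨⟨fun j hj => ?_, ?_⟩, ?_, ?_⟩
      · simp [State.upd_apply, f1]
        exact k1 j hj
      · simp [State.upd_apply, f1, k2]
      · simp [State.upd_apply, Ex.eval, f2, hp1, two_mul]
      · simp [State.upd_apply, k2]
        omega

end

end Domatic

/-! ### Tables over the listed sets, and the transforms in place. -/

namespace Domatic

open Finset RAM RAM.Pr RAM.Ex

/-! ### Tables indexed by masks -/

/-- The array `t` holds the function `g` of a set. -/
def Table (s : State) (t : Tag) (g : Finset ℕ → ℕ) : Prop := ∀ Y, s t (mask Y) = g Y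

/-- The function `g`, replaced by `g'` on the first `J` members of `l`. -/
def mix (l : List (Finset ℕ)) (J : ℕ) (g' g : Finset ℕ → ℕ) (Y : Finset ℕ) : ℕ :=
  if Y ∈ l.take J then g' Y else g Y

theorem mem_take_succ {l : List (Finset ℕ)} {J : ℕ} (hJ : J < l.length) {Y : Finset ℕ} :
    Y ∈ l.take (J + 1) ↔ Y ∈ l.take J ∨ Y = l[J] := by
  rw [← List.take_append_getElem hJ, List.mem_append, List.mem_singleton]

theorem getElem_notMem_take {l : List (Finset ℕ)} (hl : l.Nodup) {J : ℕ} (hJ : J < l.length) :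
    l[J] ∉ l.take J := by
  intro h
  obtain ⟨k, hk, e⟩ := List.mem_take_iff_getElem.1 h
  have := (hl.getElem_inj_iff).1 e
  omega

theorem mix_getElem {l : List (Finset ℕ)} (hl : l.Nodup) {J : ℕ} (hJ : J < l.length)
    (g' g : Finset ℕ → ℕ) : mix l J g' g l[J] = g l[J] :=
  if_neg (getElem_notMem_take hl hJ)

theorem mix_zero (l : List (Finset ℕ)) (g' g : Finset ℕ → ℕ) : mix l 0 g' g = g := by
  funext Y; simp [mix]

theorem mix_length (l : List (Finset ℕ)) (g' g : Finset ℕ → ℕ) (Y : Finset ℕ) :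
    mix l l.length g' g Y = if Y ∈ l then g' Y else g Y := by
  simp [mix]

theorem Table.upd_mix {s : State} {t : Tag} {l : List (Finset ℕ)} {J : ℕ} (hJ : J < l.length)
    {g' g : Finset ℕ → ℕ} (h : Table s t (mix l J g' g)) :
    Table (s.upd t (mask l[J]) (g' l[J])) t (mix l (J + 1) g' g) := by
  intro Y
  rw [State.upd_apply]
  by_cases hY : Y = l[J]
  · subst hY
    simp [mix, mem_take_succ hJ]
  · have : mask Y ≠ mask l[J] := fun e => hY (mask_injective e)
    rw [if_neg fun h => this h.2, h Y]
    simp [mix, mem_take_succ hJ, hY]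

theorem Table.mix_succ {s : State} {t : Tag} {l : List (Finset ℕ)} (hl : l.Nodup) {J : ℕ}
    (hJ : J < l.length) {g' g : Finset ℕ → ℕ} (h : Table s t (mix l J g' g))
    (he : g' l[J] = g l[J]) : Table s t (mix l (J + 1) g' g) := by
  intro Y
  rw [h Y]
  by_cases hY : Y = l[J]
  · subst hY
    rw [mix_getElem hl hJ]
    simp [mix, mem_take_succ hJ, he]
  · simp [mix, mem_take_succ hJ, hY]

theorem Table.congr {s s' : State} {t : Tag} {g : Finset ℕ → ℕ} (h : Table s t g)
    (e : s' t = s t) : Table s' t g := fun Y => by rw [e]; exact h Y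

/-- Run `p` for every member of the stored list. -/
def forList (p : Pr) : Pr :=
  forTo .j (.sub (.var .last) (.var .first)) <|
    .seq (assign .cur (.get .list (.add (.var .first) (.var .j)))) p

section

variable {x : List ℕ} {n w : ℕ} {nb : ℕ → Finset ℕ} {l : List (Finset ℕ)}

theorem Stored.congr {s s' : State} (h : Stored s l) (h1 : s' .list = s .list)
    (h2 : s' .first = s .first) (h3 : s' .last = s .last) : Stored s' l := by
  refine ⟨fun j hj => ?_, ?_⟩
  · rw [h1, h2]
    exact h.1 j hj
  · rw [h2, h3]
    exact h.2

/-- The invariant must not depend on `j` and `cur`, as the loop itself overwrites them around each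
run of the body. -/
theorem achieves_forList {p : Pr} {s : State} {T : ℕ} (hs : Stored s l)
    (hl : ∀ S ∈ l, S ⊆ range n) (hnw : n ≤ w) (hlw : l.length < 2 ^ w)
    (hp : ∀ t ∈ [Tag.j, .cur, .list, .first, .last], t ∉ p.writes)
    (Inv : ℕ → State → Prop)
    (hInv : ∀ k s s', (∀ t, t ≠ .j → t ≠ .cur → s' t = s t) → Inv k s → Inv k s')
    (h0 : Inv 0 s)
    (hstep : ∀ J (hJ : J < l.length) s', Inv J s' → s' .cur 0 = mask l[J] →
      (∀ t ∉ Tag.j :: Tag.cur :: p.writes, s' t = s t) → Achieves x w p s' T (Inv (J + 1))) :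
    Achieves x w (forList p) s (l.length * (T + 3) + 2) (fun s' => Inv l.length s' ∧
      ∀ t ∉ Tag.j :: Tag.cur :: p.writes, s' t = s t) := by
  have hcons : ∀ t, t ∉ Tag.j :: Tag.cur :: p.writes ↔ t ∉ Tag.j ::
      (Pr.seq (assign .cur (.get .list (.add (.var .first) (.var .j)))) p).writes :=
    fun t => Iff.rfl
  refine Achieves.mono (T := l.length * ((1 + T) + 2) + 2) (.forTo (N := l.length) Inv ?_ ?_ ?_ hlw
    (hInv 0 s _ (fun t ht _ => State.upd_ne _ ht _ _) h0) ?_) (by ring_nf; omega) fun _ h => h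
  · intro t ht
    simp only [Ex.reads, Ex.var, List.cons_append, List.nil_append,
      List.mem_cons, List.not_mem_nil, or_false] at ht
    rw [← hcons]
    rcases ht with rfl | rfl
    · have := hp .last (by decide)
      simp [this]
    · have := hp .first (by decide)
      simp [this]
  · have := hp .j (by decide)
    simp [Pr.writes, Pr.assign, this]
  · simp only [Ex.eval, Ex.eval_var, hs.2]
    omega
  · intro J hJ s' hI hj hf
    have f1 : s' .list = s .list := hf .list (by rw [← hcons]; simp [hp .list (by decide)])
    have f2 : s' .first = s .first := hf .first (by rw [← hcons]; simp [hp .first (by decide)])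
    have hcur : (Ex.get .list (.add (.var .first) (.var .j))).eval x s' = mask l[J] := by
      simp only [Ex.eval, Ex.eval_var, f1, f2, hj]
      exact hs.1 J hJ
    refine .seq (.assign ?_ ((hstep J hJ _ (hInv J _ _ (fun t _ ht => State.upd_ne _ ht _ _) hI)
      ?_ ?_).mono le_rfl ?_))
    · rw [hcur]
      exact lt_two_pow_of_le (mask_lt (hl _ (List.getElem_mem hJ))) hnw
    · simpa using hcur
    · intro t ht
      rw [State.upd_ne _ fun h => ht (by simp [h])]
      exact hf t ((hcons t).1 ht)
    · intro s'' h _ _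
      exact hInv _ _ _ (fun t ht _ => State.upd_ne _ ht _ _) h

/-! ### The transforms on the machine -/

/-- Combine, in each direction in turn, the entries of the array `t` at the members of the stored
list with the entries at their lower neighbours. -/
def yates (t : Tag) (op : Ex → Ex → Ex) : Pr :=
  .seq (assign .bit (.lit 1)) <|
  forTo .i (.var .n) <|
    .seq (forList <|
      .ite (lowBit (.div (.var .cur) (.var .bit)))
        (.set t (.var .cur) (op (.get t (.var .cur)) (.get t (.sub (.var .cur) (.var .bit)))))
        .skip) <|
    assign .bit (.add (.var .bit) (.var .bit))

/-- The function `g` on the members of `l`, and `0` elsewhere. -/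
def restrict (l : List (Finset ℕ)) (g : Finset ℕ → ℕ) (Y : Finset ℕ) : ℕ := if Y ∈ l then g Y else 0

/-- Updating in place, in any order, is harmless: direction `i` changes only entries of sets
containing `i` and reads its second operand at a set without `i`. By `hg0`, the `0` stored outside
the list is the true value wherever it is read. -/
theorem achieves_yates {t : Tag} (ht : t = .zeta ∨ t = .moebius) {op : Ex → Ex → Ex}
    {o : ℕ → ℕ → ℕ} (hop : ∀ s a b, (op a b).eval x s = o (a.eval x s) (b.eval x s))
    (hnw : n + 1 ≤ w) (hnd : l.Nodup) (hl : ∀ S ∈ l, S ⊆ range n) (hlw : l.length < 2 ^ w)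
    (g : ℕ → Finset ℕ → ℕ)
    (hg : ∀ i X, g (i + 1) X = if i ∈ X then o (g i X) (g i (X.erase i)) else g i X)
    (hg0 : ∀ i, ∀ X ∈ l, X.erase i ∉ l → g i (X.erase i) = 0)
    (hgw : ∀ i, ∀ X ∈ l, g i X < 2 ^ w) {s : State} (hsn : s .n 0 = n) (hs : Stored s l)
    (hT : Table s t (restrict l (g 0))) :
    Achieves x w (yates t op) s (n * (l.length * 5 + 5) + 3) (fun s' =>
      Table s' t (restrict l (g n)) ∧ ∀ t' ∉ (yates t op).writes, s' t' = s t') := by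
  have ht0 : ∀ t' ∈ [Tag.i, .j, .cur, .list, .first, .last, .bit, .n], t' ≠ t := by
    rcases ht with rfl | rfl <;> decide
  have htb : t ≠ Tag.bit := (ht0 .bit (by decide)).symm
  have htj : t ≠ Tag.j := (ht0 .j (by decide)).symm
  have hti : t ≠ Tag.i := (ht0 .i (by decide)).symm
  have htc : t ≠ Tag.cur := (ht0 .cur (by decide)).symm
  have hpw : ∀ k ≤ n + 1, 2 ^ k ≤ 2 ^ w := fun k hk => Nat.pow_le_pow_right (by norm_num) (by omega)
  refine Achieves.mono (T := 1 + (n * ((l.length * ((1 + 1) + 3) + 2 + 1) + 2) + 2))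
    (Achieves.with_frame (.seq (.assign ?_ (.forTo (N := n) (fun i s' =>
      Table s' t (restrict l (g i)) ∧ s' .bit 0 = 2 ^ i) ?_ ?_ ?_ ?_ ?_ ?_)))) (by ring_nf; omega)
    fun s' h => ⟨h.1.1.1, h.2⟩
  · exact lt_two_pow_of_le (e := 1) (by simp [Ex.eval]) (by omega)
  · rcases ht with rfl | rfl <;> simp [Pr.writes, Pr.assign, Pr.forTo, forList, Ex.reads, Ex.var]
  · rcases ht with rfl | rfl <;> simp [Pr.writes, Pr.assign, Pr.forTo, forList, Ex.var]
  · simpa [State.upd_apply] using hsn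
  · exact lt_two_pow_of_le Nat.lt_two_pow_self (by omega)
  · refine ⟨hT.congr ?_, by simp [State.upd_apply, Ex.eval]⟩
    rw [State.upd_ne _ hti, State.upd_ne _ htb]
  · rintro i hi s₁ ⟨hT₁, hb⟩ - hf
    have hs₁ : Stored s₁ l := by
      refine hs.congr ?_ ?_ ?_
      · rw [hf .list (by
            rcases ht with rfl | rfl <;> simp [Pr.writes, Pr.assign, Pr.forTo, forList]),
          State.upd_ne _ (by decide)]
      · rw [hf .first (by
            rcases ht with rfl | rfl <;> simp [Pr.writes, Pr.assign, Pr.forTo, forList]),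
          State.upd_ne _ (by decide)]
      · rw [hf .last (by
            rcases ht with rfl | rfl <;> simp [Pr.writes, Pr.assign, Pr.forTo, forList]),
          State.upd_ne _ (by decide)]
    refine .seq ((achieves_forList hs₁ hl (by omega) hlw
      (by rcases ht with rfl | rfl <;> simp [Pr.writes])
      (fun J s' => Table s' t (mix l J (restrict l (g (i + 1))) (restrict l (g i)))) ?_ ?_ ?_).mono
      le_rfl ?_)
    · exact fun k s s' h hT => hT.congr (h t htj htc)
    · rwa [mix_zero]
    · intro J hJ s₂ hT₂ hc hf₂
      have hmem : l[J] ∈ l := List.getElem_mem hJ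
      have hb₂ : s₂ .bit 0 = 2 ^ i := by
        rw [hf₂ .bit (by rcases ht with rfl | rfl <;> simp [Pr.writes]), hb]
      have htest : (lowBit (.div (.var .cur) (.var .bit))).eval x s₂ =
          if i ∈ l[J] then 1 else 0 := by
        rw [eval_lowBit, ← mask_div_mod]
        simp [Ex.eval, hc, hb₂]
      refine .ite (fun h => ?_) fun h => ?_
      · have hiX : i ∈ l[J] := by
          by_contra hc
          simp [htest, hc] at h
        have e1 : s₂ t (mask l[J]) = g i l[J] := by
          rw [hT₂, mix_getElem hnd hJ, restrict, if_pos hmem]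
        have e2 : s₂ t (mask l[J] - 2 ^ i) = g i (l[J].erase i) := by
          rw [← mask_erase hiX, hT₂]
          -- A listed lower neighbour may or may not have been visited, but stages `i` and `i + 1`
          -- agree there; an unlisted one has value `0`.
          by_cases hX : l[J].erase i ∈ l
          · simp [mix, restrict, hX, hg]
          · simp [mix, restrict, hX, hg0 i _ hmem hX]
        have hv : (op (.get t (.var .cur)) (.get t (.sub (.var .cur) (.var .bit)))).eval x s₂ =
            restrict l (g (i + 1)) l[J] := by
          rw [hop, restrict, if_pos hmem, hg, if_pos hiX]
          simp [Ex.eval, hc, hb₂, e1, e2]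
        refine .set ?_ ?_
        · rw [hv, restrict, if_pos hmem]
          exact hgw _ _ hmem
        · rw [hv, Ex.eval_var, hc]
          exact hT₂.upd_mix hJ
      · have hiX : i ∉ l[J] := by
          intro hc
          simp [htest, hc] at h
        refine .skip (hT₂.mix_succ hnd hJ ?_)
        rw [restrict, restrict, hg, if_neg hiX]
    · rintro s₂ ⟨hT₂, hf₂⟩
      have hb₂ : s₂ .bit 0 = 2 ^ i := by
        rw [hf₂ .bit (by rcases ht with rfl | rfl <;> simp [Pr.writes]), hb]
      have e : 2 ^ i + 2 ^ i = 2 ^ (i + 1) := by ring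
      refine .assign ?_ fun _ _ => ⟨fun Y => ?_, by simp [State.upd_apply, Ex.eval, hb₂, e]⟩
      · simp only [Ex.eval, Ex.eval_var, hb₂, e]
        have := hpw (i + 1 + 1) (by omega)
        have : 2 ^ (i + 1) < 2 ^ (i + 1 + 1) := Nat.pow_lt_pow_right (by norm_num) (by omega)
        omega
      · rw [State.upd_ne _ hti, State.upd_ne _ htb, hT₂, mix_length]
        simp only [restrict]
        split_ifs <;> rfl

end

end Domatic

/-! ### Weights, powers, detection, and their assembly. -/

namespace Domatic

open Finset RAM RAM.Pr RAM.Ex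

/-! ### The whole program -/

/-- Store the weights `base ^ |X|` of the listed sets `X`. -/
def weigh : Pr :=
  forList <|
    .seq (assign .rest (.var .cur)) <|
    .seq (assign .acc (.lit 1)) <|
    .seq (forTo .u (.var .n) <|
      .seq (.ite (lowBit (.var .rest)) (assign .acc (.mul (.var .acc) (.var .base))) .skip) <|
      assign .rest (.div (.var .rest) (.lit 2))) <|
    .seq (.set .weight (.var .cur) (.var .acc)) <|
    .seq (.set .zeta (.var .cur) (.var .acc)) <|
    .set .power (.var .cur) (.lit 1)

section

variable {x : List ℕ} {n w B : ℕ} {nb : ℕ → Finset ℕ} {l : List (Finset ℕ)}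

/-- One factor `B` is picked up for every binary digit `1` of the mask. -/
theorem achieves_acc (hnw : n < 2 ^ w) (hBw : B ^ n < 2 ^ w) (hB : 0 < B) {X : Finset ℕ}
    (hX : X ⊆ range n) (hXw : mask X < 2 ^ w) {s : State} (hsn : s .n 0 = n) (hsB : s .base 0 = B)
    (hr : s .rest 0 = mask X) (ha : s .acc 0 = 1) :
    Achieves x w (forTo .u (.var .n) <|
      .seq (.ite (lowBit (.var .rest)) (assign .acc (.mul (.var .acc) (.var .base))) .skip) <|
      assign .rest (.div (.var .rest) (.lit 2))) s (n * 5 + 2) (fun s' => s' .acc 0 = B ^ X.card ∧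
        ∀ t ∉ [Tag.u, .acc, .rest], s' t = s t) := by
  refine Achieves.mono (.forTo (N := n) (T := 1 + 1 + 1) (fun k s' =>
    s' .acc 0 = B ^ (X.filter (· < k)).card ∧ s' .rest 0 = mask X / 2 ^ k) (by decide) (by decide)
    (by simpa using hsn) hnw ?_ ?_) (by omega) fun s' h => ⟨?_, h.2⟩
  · simp [State.upd_apply, ha, hr]
  · rintro u hu s' ⟨k1, k2⟩ - hf
    have fB : s' .base 0 = B := by rw [hf .base (by decide), hsB]
    have e2 : mask X / 2 ^ (u + 1) = mask X / 2 ^ u / 2 := by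
      rw [pow_succ, Nat.div_div_eq_div_mul]
    have hrest : mask X / 2 ^ u / 2 < 2 ^ w :=
      ((Nat.div_le_self _ _).trans (Nat.div_le_self _ _)).trans_lt hXw
    have hcn : (X.filter (· < u + 1)).card ≤ n := by
      simpa using card_le_card ((filter_subset _ X).trans hX)
    refine .seq (T := 1 + 1) (T' := 1) (.ite (fun h => ?_) fun h => ?_)
    · have hu : u ∈ X := by
        by_contra hc
        simp [k2, mask_div_mod, hc] at h
      have hc : (X.filter (· < u + 1)).card = (X.filter (· < u)).card + 1 := by
        rw [← card_insert_of_notMem (a := u) (by simp)]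
        congr 1
        ext v
        simp only [mem_filter, mem_insert]
        constructor
        · rintro ⟨h1, h2⟩
          by_cases e : v = u
          · exact Or.inl e
          · exact Or.inr ⟨h1, by omega⟩
        · rintro (rfl | ⟨h1, h2⟩)
          · exact ⟨hu, by omega⟩
          · exact ⟨h1, by omega⟩
      have hacc : (Ex.mul (.var .acc) (.var .base)).eval x s' =
          B ^ (X.filter (· < u + 1)).card := by
        rw [hc, pow_succ]
        simp [Ex.eval, k1, fB]
      refine .assign ?_ (.assign ?_ fun _ _ => ?_)
      · rw [hacc]
        exact (Nat.pow_le_pow_right hB hcn).trans_lt hBw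
      · simpa [Ex.eval, State.upd_apply, k2] using hrest
      · rw [hacc]
        simp [State.upd_apply, Ex.eval, k2, e2]
    · have hu : u ∉ X := by
        intro hc
        simp [k2, mask_div_mod, hc] at h
      have hc : X.filter (· < u + 1) = X.filter (· < u) := by
        refine filter_congr fun v hv => ?_
        have : v ≠ u := fun h => hu (h ▸ hv)
        omega
      refine .skip (.assign ?_ fun _ _ => ?_)
      · simpa [Ex.eval, State.upd_apply, k2] using hrest
      · rw [hc]
        simp [State.upd_apply, Ex.eval, k1, k2, e2]
  · rw [h.1.1, filter_true_of_mem fun v hv => mem_range.1 (hX hv)]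

theorem achieves_weigh (hnw : n ≤ w) (hw : 1 ≤ w) (hBw : B ^ n < 2 ^ w) (hB : 0 < B)
    (hl : ∀ S ∈ l, S ⊆ range n) (hlw : l.length < 2 ^ w) {s : State} (hs : Stored s l)
    (hsn : s .n 0 = n) (hsB : s .base 0 = B) (hz : s .zeta = fun _ => 0) :
    Achieves x w weigh s (l.length * (n * 5 + 10) + 2) (fun s' =>
      Table s' .zeta (restrict l fun X => B ^ X.card) ∧
      (∀ X ∈ l, s' .weight (mask X) = B ^ X.card) ∧ (∀ X ∈ l, s' .power (mask X) = 1) ∧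
      ∀ t ∉ weigh.writes, s' t = s t) := by
  have h1w : 1 < 2 ^ w := lt_two_pow_of_le (e := 1) (by norm_num) hw
  refine Achieves.mono (achieves_forList (T := 1 + (1 + ((n * 5 + 2) + (1 + (1 + 1))))) hs hl hnw
    hlw (by decide) (fun J s' =>
      Table s' .zeta (mix l J (fun X => B ^ X.card) fun _ => 0) ∧
      (∀ X ∈ l.take J, s' .weight (mask X) = B ^ X.card) ∧
      (∀ X ∈ l.take J, s' .power (mask X) = 1)) ?_ ?_ ?_).with_frame (by ring_nf; omega)
    fun s' h => ⟨fun Y => ?_, ?_, ?_, h.2⟩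
  · rintro k s s' h ⟨h1, h2, h3⟩
    refine ⟨h1.congr (h _ (by decide) (by decide)), ?_, ?_⟩
    · rwa [h .weight (by decide) (by decide)]
    · rwa [h .power (by decide) (by decide)]
  · rw [mix_zero]
    exact ⟨fun Y => by rw [hz], by simp, by simp⟩
  · rintro J hJ s₁ ⟨k1, k2, k3⟩ hc hf
    have hX := hl _ (List.getElem_mem hJ)
    have hXw : mask l[J] < 2 ^ w := lt_two_pow_of_le (mask_lt hX) hnw
    have hcn : (l[J]).card ≤ n := by simpa using card_le_card hX
    refine .seq (.assign (by simpa [hc] using hXw) (.seq (.assign (by simpa [Ex.eval] using h1w)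
      (.seq ((achieves_acc (B := B) (lt_two_pow_of_le Nat.lt_two_pow_self hnw) hBw hB hX hXw
        ?_ ?_ ?_ ?_).mono le_rfl ?_)))))
    · simp [State.upd_apply, hf .n (by decide), hsn]
    · simp [State.upd_apply, hf .base (by decide), hsB]
    · simp [State.upd_apply, hc]
    · simp [Ex.eval]
    rintro s₂ ⟨q1, q2⟩
    have fc : s₂ .cur 0 = mask l[J] := by
      rw [q2 .cur (by decide)]
      simpa [State.upd_apply] using hc
    have fz : s₂ .zeta = s₁ .zeta := by
      rw [q2 .zeta (by decide), State.upd_ne _ (by decide), State.upd_ne _ (by decide)]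
    have fw : s₂ .weight = s₁ .weight := by
      rw [q2 .weight (by decide), State.upd_ne _ (by decide), State.upd_ne _ (by decide)]
    have fp : s₂ .power = s₁ .power := by
      rw [q2 .power (by decide), State.upd_ne _ (by decide), State.upd_ne _ (by decide)]
    have hacc : B ^ (l[J]).card < 2 ^ w := (Nat.pow_le_pow_right hB hcn).trans_lt hBw
    refine .seq (.set (by simpa [q1] using hacc) (.seq (.set
      (by simpa [State.upd_apply, q1] using hacc)
      (.set (by simpa [Ex.eval] using h1w) ⟨?_, ?_, ?_⟩))))
    · refine Table.congr (s := s₁.upd .zeta (mask l[J]) (B ^ (l[J]).card)) (k1.upd_mix hJ) ?_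
      funext a
      simp [State.upd_apply, fc, q1, fz]
    · intro X hX
      rw [mem_take_succ hJ] at hX
      by_cases e : X = l[J]
      · simp [State.upd_apply, fc, e, q1]
      · have e' : mask X ≠ mask l[J] := fun h => e (mask_injective h)
        simp [State.upd_apply, fc, e', fw, k2 X (hX.resolve_right e)]
    · intro X hX
      rw [mem_take_succ hJ] at hX
      by_cases e : X = l[J]
      · simp [State.upd_apply, fc, e, Ex.eval]
      · have e' : mask X ≠ mask l[J] := fun h => e (mask_injective h)
        simp [State.upd_apply, fc, e', fp, k3 X (hX.resolve_right e)]
  · rw [h.1.1.1, mix_length, restrict]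
  · simpa using h.1.1.2.1
  · simpa using h.1.1.2.2

/-- Multiply the powers of the zeta transform by one more factor. -/
def raise : Pr :=
  forList <|
    .seq (.set .power (.var .cur) (.mul (.get .power (.var .cur)) (.get .zeta (.var .cur)))) <|
    .set .moebius (.var .cur) (.get .power (.var .cur))

/-- The power is copied to `moebius` so that the inversion in place leaves it intact for the next
round. Unlisted cells of `moebius` stay `0`, as the transform requires. -/
theorem achieves_raise (hnw : n ≤ w) (hnd : l.Nodup) (hl : ∀ S ∈ l, S ⊆ range n)
    (hlw : l.length < 2 ^ w) {q : ℕ} {z : Finset ℕ → ℕ} (hzw : ∀ X ∈ l, z X ^ (q + 1) < 2 ^ w)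
    {s : State} (hs : Stored s l) (hz : ∀ X ∈ l, s .zeta (mask X) = z X)
    (hp : ∀ X ∈ l, s .power (mask X) = z X ^ q) (hm : ∀ Y ∉ l, s .moebius (mask Y) = 0) :
    Achieves x w raise s (l.length * 5 + 2) (fun s' =>
      (∀ X ∈ l, s' .power (mask X) = z X ^ (q + 1)) ∧
      Table s' .moebius (restrict l fun X => z X ^ (q + 1)) ∧
      ∀ t ∉ raise.writes, s' t = s t) := by
  refine Achieves.mono (achieves_forList (T := 1 + 1) hs hl hnw hlw (by decide) (fun J s' =>
      Table s' .power (mix l J (fun X => z X ^ (q + 1)) fun X => s .power (mask X)) ∧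
      Table s' .moebius (mix l J (fun X => z X ^ (q + 1)) fun X => s .moebius (mask X)))
      ?_ ?_ ?_).with_frame (by omega)
    fun s' h => ⟨fun X hX => ?_, fun Y => ?_, h.2⟩
  · rintro k s s' h ⟨h1, h2⟩
    exact ⟨h1.congr (h _ (by decide) (by decide)), h2.congr (h _ (by decide) (by decide))⟩
  · rw [mix_zero, mix_zero]
    exact ⟨fun _ => rfl, fun _ => rfl⟩
  · rintro J hJ s₁ ⟨k1, k2⟩ hc hf
    have hX : l[J] ∈ l := List.getElem_mem hJ
    have fz : s₁ .zeta (mask l[J]) = z l[J] := by rw [hf .zeta (by decide), hz _ hX]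
    have fp : s₁ .power (mask l[J]) = z l[J] ^ q := by rw [k1, mix_getElem hnd hJ, hp _ hX]
    have hv : (Ex.mul (.get .power (.var .cur)) (.get .zeta (.var .cur))).eval x s₁ =
        z l[J] ^ (q + 1) := by
      simp [Ex.eval, hc, fz, fp, pow_succ]
    refine .seq (.set ?_ (.set ?_ ⟨?_, ?_⟩))
    · rw [hv]
      exact hzw _ hX
    · rw [hv]
      simpa [Ex.eval, State.upd_apply, hc] using hzw _ hX
    · rw [hv]
      refine Table.congr (k1.upd_mix hJ) ?_
      rw [State.upd_ne _ (by decide), Ex.eval_var, hc]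
    · rw [hv]
      refine Table.congr (k2.upd_mix hJ) ?_
      funext a
      simp [State.upd_apply, Ex.eval, hc]
  · rw [h.1.1.1, mix_length, if_pos hX]
  · rw [h.1.1.2, mix_length, restrict]
    split_ifs with hY
    · rfl
    · exact hm Y hY

/-- The remainder of the inverted entry of the current set modulo `base ^ (|X| + 1)`. -/
def remainder : Ex :=
  let m := Ex.mul (.var .base) (.get .weight (.var .cur))
  .sub (.get .moebius (.var .cur)) (.mul (.div (.get .moebius (.var .cur)) m) m)

/-- Record `q + 2` as the result if some remainder is not `0`. -/
def detect : Pr :=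
  forList <| .ite remainder (assign .out (.add (.var .q) (.lit 2))) .skip

/-- Round `q` tests partitions into `q + 1` members; the complement of the partitioned set is one
more dominating set, hence `q + 2`. A later success overwrites an earlier one. -/
theorem achieves_detect (hnw : n + 2 ≤ w) (hl : ∀ S ∈ l, S ⊆ range n) (hlw : l.length < 2 ^ w)
    {q r : ℕ} (hq : q ≤ n) {g : Finset ℕ → ℕ} {s : State} (hs : Stored s l)
    (hsB : s .base 0 = B) (hwt : ∀ X ∈ l, s .weight (mask X) = B ^ X.card)
    (hm : ∀ X ∈ l, s .moebius (mask X) = g X) (hsq : s .q 0 = q) (hr : s .out 0 = r) :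
    Achieves x w detect s (l.length * 5 + 2) (fun s' =>
      ((∃ X ∈ l, g X % B ^ (X.card + 1) ≠ 0) → s' .out 0 = q + 2) ∧
      ((∀ X ∈ l, g X % B ^ (X.card + 1) = 0) → s' .out 0 = r) ∧
      ∀ t ∉ detect.writes, s' t = s t) := by
  refine Achieves.mono (achieves_forList (T := 1 + 1) hs hl (by omega) hlw (by decide) (fun J s' =>
      ((∃ X ∈ l.take J, g X % B ^ (X.card + 1) ≠ 0) → s' .out 0 = q + 2) ∧
      ((∀ X ∈ l.take J, g X % B ^ (X.card + 1) = 0) → s' .out 0 = r))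
      ?_ ?_ ?_).with_frame (by omega)
    fun s' h => ⟨by simpa using h.1.1.1, by simpa using h.1.1.2, h.2⟩
  · rintro k s s' h ⟨h1, h2⟩
    rw [h .out (by decide) (by decide)]
    exact ⟨h1, h2⟩
  · simp [hr]
  · rintro J hJ s₁ ⟨k1, k2⟩ hc hf
    have hX : l[J] ∈ l := List.getElem_mem hJ
    have hv : remainder.eval x s₁ = g l[J] % B ^ ((l[J]).card + 1) := by
      simp only [remainder, Ex.eval, Ex.eval_var, hc, hf .base (by decide), hsB,
        hf .weight (by decide), hwt _ hX, hf .moebius (by decide), hm _ hX]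
      rw [pow_succ', Nat.mod_eq_sub_div_mul]
    refine .ite (fun h => ?_) fun h => ?_
    · rw [hv] at h
      refine .assign ?_ ⟨fun _ => ?_, fun hall =>
        absurd (hall _ ((mem_take_succ hJ).2 (Or.inr rfl))) h⟩
      · have : q + 2 < 2 ^ w := lt_two_pow_of_le (Nat.lt_two_pow_self (n := q + 2)) (by omega)
        simpa [Ex.eval, hf .q (by decide), hsq] using this
      · simp [Ex.eval, hf .q (by decide), hsq]
    · rw [hv] at h
      refine .skip ⟨?_, fun hall => k2 fun X hX => hall X ((mem_take_succ hJ).2 (Or.inl hX))⟩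
      rintro ⟨X, hX, hne⟩
      rcases (mem_take_succ hJ).1 hX with hX | rfl
      · exact k1 ⟨X, hX, hne⟩
      · exact absurd h hne

/-- Compute the domatic number. -/
def domatic : Pr :=
  .seq (assign .n (.inp (.lit 0))) <|
  .seq (assign .base (.lit 1)) <|
  .seq (forTo .u (.mul (.var .n) (.var .n)) (assign .base (.add (.var .base) (.var .base)))) <|
  .seq enumerate <|
  .seq weigh <|
  .seq (yates .zeta .add) <|
  .seq (assign .out (.lit 1)) <|
  forTo .q (.sub (.var .n) (.lit 1)) <|
    .seq raise <|
    .seq (yates .moebius .sub) <|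
    detect

end

end Domatic

namespace Domatic

open Finset RAM RAM.Pr RAM.Ex

section

variable {x : List ℕ} {n w : ℕ} {nb : ℕ → Finset ℕ}

/-- Convexity of the family: a set between two members meets every `nb v` because the smaller one
does, and contains none because the larger one does not. -/
theorem not_subset_erase_of_notMem_layer (hnb : ∀ v < n, (nb v).Nonempty) {i : ℕ} {X : Finset ℕ}
    (hX : X ∈ layer nb n n) (hE : X.erase i ∉ layer nb n n) :
    ∀ S ∈ (layer nb n n).toFinset, ¬ S ⊆ X.erase i := by
  intro S hS hSX
  rw [List.mem_toFinset, mem_layer hnb] at hS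
  rw [mem_layer hnb] at hX hE
  refine hE ⟨(erase_subset i X).trans hX.1, fun v hv hvn => ⟨?_, fun h => ?_⟩⟩
  · exact (hS.2 v hv hvn).1.mono (inter_subset_inter_left hSX)
  · exact (hX.2 v hv hvn).2 (h.trans (erase_subset i X))

/-- `r` is the largest number, at most `k + 1`, that is `1` or has a predecessor with property
`P`. -/
def IsBest (P : ℕ → Prop) (k r : ℕ) : Prop :=
  1 ≤ r ∧ r ≤ k + 1 ∧ (r = 1 ∨ P (r - 1)) ∧ ∀ q, r ≤ q → q ≤ k → ¬ P q

theorem sum_weights_le {F : Finset (Finset ℕ)} (hF : ∀ S ∈ F, S ⊆ range n) {B : ℕ} (hB : 0 < B)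
    (X : Finset ℕ) : ∑ S ∈ F with S ⊆ X, B ^ S.card ≤ 2 ^ n * B ^ n := by
  calc _ ≤ ∑ S ∈ F, B ^ S.card := sum_le_sum_of_subset (filter_subset _ _)
    _ ≤ ∑ _S ∈ F, B ^ n := sum_le_sum fun S hS =>
        Nat.pow_le_pow_right hB (by simpa using card_le_card (hF S hS))
    _ = F.card * B ^ n := by rw [sum_const, smul_eq_mul]
    _ ≤ _ := Nat.mul_le_mul_right _ (by
        simpa using card_le_card (fun S hS => mem_powerset.2 (hF S hS) : F ⊆ (range n).powerset))

/-- The number of steps of the main program. -/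
def domaticSteps (n M : ℕ) : ℕ := 300 * (n ^ 4 * M)

theorem achieves_domatic (hx : Describes x n nb) (hn : 1 ≤ n)
    (hw : (n + n * n * n) * n + n * n + 2 * n + 3 ≤ w) {M : ℕ} (hM1 : 1 ≤ M)
    (hM : ∀ i ≤ n, (layer nb n i).length ≤ M) :
    Achieves x w domatic (fun _ _ => 0) (domaticSteps n M) (fun s' => s' .n 0 = n ∧
      IsBest (fun q => ∃ X ∈ layer nb n n, Partitions (layer nb n n).toFinset q X) (n - 1)
        (s' .out 0)) := by
  have hx0 : x[0]?.getD 0 = n := by simpa using hx.size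
  have hnb : ∀ v < n, (nb v).Nonempty := fun v hv => ⟨v, hx.self v hv⟩
  have hnd := nodup_layer hnb n
  have hl : ∀ S ∈ layer nb n n, S ⊆ range n := fun S hS => ((mem_layer hnb).1 hS).1
  have hlen := length_layer_le (nb := nb) (n := n) n
  have hconv := fun (i : ℕ) (X : Finset ℕ) => @not_subset_erase_of_notMem_layer n nb hnb i X
  have hlM := hM n le_rfl
  generalize hL : layer nb n n = l at *
  set F := l.toFinset with hF
  have hFl : ∀ S, S ∈ F ↔ S ∈ l := fun S => List.mem_toFinset
  have hFsub : ∀ S ∈ F, S ⊆ range n := fun S hS => hl S ((hFl S).1 hS)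
  set B := 2 ^ (n * n) with hBdef
  have hB : 0 < B := by positivity
  have hBn : B ^ n = 2 ^ (n * n * n) := by rw [hBdef, ← pow_mul]
  set f : Finset ℕ → ℕ := fun S => B ^ S.card with hf
  set z : Finset ℕ → ℕ := fun X => ∑ S ∈ F with S ⊆ X, f S with hz
  have hpos : 0 ≤ (n + n * n * n) * n := Nat.zero_le _
  have h1w : 1 < 2 ^ w := lt_two_pow_of_le (e := 1) (by norm_num) (by omega)
  have hnw : n < 2 ^ w := lt_two_pow_of_le Nat.lt_two_pow_self (by omega)
  have hnnn : n * n * n ≤ (n + n * n * n) * n := by nlinarith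
  have hBnw : B ^ n < 2 ^ w := by
    rw [hBn]
    exact Nat.pow_lt_pow_right (by norm_num) (by omega)
  have hlw : l.length < 2 ^ w := hlen.trans_lt (Nat.pow_lt_pow_right (by norm_num) (by omega))
  -- These powers are the largest numbers that occur; they account for the term `(n + n * n * n) *
  -- n` of the word size.
  have hzw : ∀ q ≤ n, ∀ X, z X ^ q < 2 ^ w := fun q hq X => by
    calc z X ^ q ≤ (2 ^ n * B ^ n) ^ q := Nat.pow_le_pow_left (sum_weights_le hFsub hB X) q
      _ ≤ (2 ^ n * B ^ n) ^ n := Nat.pow_le_pow_right (by positivity) hq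
      _ = 2 ^ ((n + n * n * n) * n) := by rw [hBn, ← pow_add, ← pow_mul]
      _ < 2 ^ w := Nat.pow_lt_pow_right (by norm_num) (by omega)
  -- This is why the base is `2 ^ (n * n)`: there are at most `2 ^ (n * q)` tuples, and `q ≤ n - 1`
  -- in all rounds.
  have hcard : ∀ q < n, F.card ^ q < B := fun q hq => by
    calc F.card ^ q ≤ (2 ^ n) ^ q := Nat.pow_le_pow_left
          ((List.toFinset_card_le l).trans hlen) q
      _ = 2 ^ (n * q) := by rw [← pow_mul]
      _ < B := Nat.pow_lt_pow_right (by norm_num) (Nat.mul_lt_mul_of_pos_left hq (by omega))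
  -- The summands are the phases of the program. After shifting `n` and `M` by `1`, the bound holds
  -- coefficient by coefficient.
  have hsteps : 1 + (1 + ((n * n * (1 + 2) + 2) + ((n * (M * (n * (n * 14 + 20) + 17) + 7) + 6) +
      ((M * (n * 5 + 10) + 2) + ((n * (M * 5 + 5) + 3) + (1 +
      (n * (((M * 5 + 2) + ((n * (M * 5 + 5) + 3) + (M * 5 + 2))) + 2) + 2))))))) ≤
      domaticSteps n M := by
    obtain ⟨a, rfl⟩ : ∃ a, n = a + 1 := ⟨n - 1, by omega⟩
    obtain ⟨b, rfl⟩ : ∃ b, M = b + 1 := ⟨M - 1, by omega⟩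
    rw [domaticSteps]
    ring_nf
    omega
  refine Achieves.mono ?_ hsteps fun s' h => h
  refine .seq (.assign (by simpa [Ex.eval, hx0] using hnw) ?_)
  refine .seq (.assign (by simpa [Ex.eval] using h1w) ?_)
  refine .seq ((Achieves.forTo (N := n * n) (T := 1) (fun k s' => s' .base 0 = 2 ^ k) (by decide)
    (by decide) ?_ ?_ ?_ ?_).mono le_rfl ?_)
  · simp [State.upd_apply, Ex.eval, hx0]
  · exact lt_two_pow_of_le Nat.lt_two_pow_self (by omega)
  · simp [State.upd_apply, Ex.eval]
  · intro k hk s' hb _ _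
    have e : 2 ^ k + 2 ^ k = 2 ^ (k + 1) := by ring
    refine .assign ?_ fun _ _ => ?_
    · simp only [Ex.eval, Ex.eval_var, hb, e]
      exact Nat.pow_lt_pow_right (by norm_num) (by omega)
    · simp [State.upd_apply, Ex.eval, hb, e]
  rintro s₁ ⟨hb₁, hf₁⟩
  have hn₁ : s₁ .n 0 = n := by rw [hf₁ .n (by decide)]; simp [State.upd_apply, Ex.eval, hx0]
  have hz₁ : s₁ .zeta = fun _ => 0 := by
    rw [hf₁ .zeta (by decide)]; funext a; simp [State.upd_apply]
  have hm₁ : s₁ .moebius = fun _ => 0 := by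
    rw [hf₁ .moebius (by decide)]; funext a; simp [State.upd_apply]
  refine .seq ((achieves_enumerate hx (by omega) hM hn₁).mono le_rfl ?_)
  rintro s₂ ⟨hs₂, hf₂⟩
  rw [hL] at hs₂
  refine .seq ((achieves_weigh (B := B) (by omega) (by omega) hBnw hB hl hlw hs₂ ?_ ?_ ?_).mono
    (by gcongr) ?_)
  · rw [hf₂ .n (by decide), hn₁]
  · rw [hf₂ .base (by decide), hb₁]
  · rw [hf₂ .zeta (by decide), hz₁]
  rintro s₃ ⟨hz₃, hwt₃, hp₃, hf₃⟩
  have hs₃ : Stored s₃ l := hs₂.congr (hf₃ _ (by decide)) (hf₃ _ (by decide)) (hf₃ _ (by decide))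
  refine .seq ((achieves_yates (Or.inl rfl) (o := (· + ·)) (fun _ _ _ => rfl) (by omega) hnd hl hlw
    (fun i => zetaStage F f i) (fun i X => zetaStage_succ i X)
    (fun i X hX hE => zetaStage_eq_zero (hconv i X hX hE) i) ?_ ?_ hs₃ ?_).mono (by gcongr) ?_)
  · intro i X _
    have := hzw 1 hn X
    rw [pow_one] at this
    exact (zetaStage_le i X).trans_lt this
  · rw [hf₃ .n (by decide), hf₂ .n (by decide), hn₁]
  · intro Y
    rw [hz₃ Y, restrict, restrict, zetaStage_zero]
    simp only [hFl]
    split_ifs <;> rfl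
  rintro s₄ ⟨hz₄, hf₄⟩
  have hs₄ : Stored s₄ l := hs₃.congr (hf₄ _ (by decide)) (hf₄ _ (by decide)) (hf₄ _ (by decide))
  have hn₄ : s₄ .n 0 = n := by
    rw [hf₄ .n (by decide), hf₃ .n (by decide), hf₂ .n (by decide), hn₁]
  have hB₄ : s₄ .base 0 = B := by
    rw [hf₄ .base (by decide), hf₃ .base (by decide), hf₂ .base (by decide), hb₁]
  have hm₄ : s₄ .moebius = fun _ => 0 := by
    rw [hf₄ .moebius (by decide), hf₃ .moebius (by decide), hf₂ .moebius (by decide), hm₁]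
  have hz₄' : ∀ X ∈ l, s₄ .zeta (mask X) = z X := fun X hX => by
    rw [hz₄, restrict, if_pos hX, zetaStage_last (hl X hX)]
  refine .seq (.assign (by simpa [Ex.eval] using h1w) ?_)
  refine Achieves.mono (.forTo (N := n - 1)
    (T := (M * 5 + 2) + ((n * (M * 5 + 5) + 3) + (M * 5 + 2)))
    (fun k s' => (∀ X ∈ l, s' .power (mask X) = z X ^ k) ∧ (∀ Y ∉ l, s' .moebius (mask Y) = 0) ∧
      IsBest (fun q => ∃ X ∈ l, Partitions F q X) k (s' .out 0)) (by decide) (by decide)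
      ?_ ?_ ?_ ?_) (by gcongr; omega) fun s' h => ⟨?_, h.1.2.2⟩
  · simp [State.upd_apply, Ex.eval, hn₄]
  · omega
  · refine ⟨fun X hX => ?_, fun Y _ => ?_, ?_⟩
    · rw [State.upd_ne _ (by decide), State.upd_ne _ (by decide), hf₄ .power (by decide),
        hp₃ X hX, pow_zero]
    · rw [State.upd_ne _ (by decide), State.upd_ne _ (by decide), hm₄]
    · simp [State.upd_apply, Ex.eval, IsBest]
      omega
  · rintro q hq s₅ ⟨hp₅, hm₅, hbest⟩ hq₅ hf₅
    have g := fun t ht ht' => (hf₅ t ht).trans (State.upd_ne s₄ ht' _ _)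
    have hs₅ : Stored s₅ l := hs₄.congr (g _ (by decide) (by decide)) (g _ (by decide) (by decide))
      (g _ (by decide) (by decide))
    refine .seq ((achieves_raise (by omega) hnd hl hlw (fun X _ => hzw (q + 1) (by omega) X) hs₅
      ?_ hp₅ hm₅).mono (by gcongr) ?_)
    · intro X hX
      rw [g .zeta (by decide) (by decide), hz₄' X hX]
    rintro s₆ ⟨hp₆, hm₆, hf₆⟩
    have hs₆ : Stored s₆ l := hs₅.congr (hf₆ _ (by decide)) (hf₆ _ (by decide)) (hf₆ _ (by decide))
    refine .seq ((achieves_yates (Or.inr rfl) (o := (· - ·)) (fun _ _ _ => rfl) (by omega) hnd hl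
      hlw (fun i => coverStage F f (q + 1) i) (fun i X => coverStage_succ (q + 1) i X)
      (fun i X hX hE => coverStage_eq_zero (Nat.succ_ne_zero q) (hconv i X hX hE) i) ?_ ?_ hs₆
      ?_).mono (by gcongr) ?_)
    · exact fun i X _ => (coverStage_le (q + 1) i X).trans_lt (hzw (q + 1) (by omega) X)
    · rw [hf₆ .n (by decide), g .n (by decide) (by decide), hn₄]
    · intro Y
      rw [hm₆ Y, restrict, restrict, coverStage_zero]
    rintro s₇ ⟨hm₇, hf₇⟩
    have hs₇ : Stored s₇ l := hs₆.congr (hf₇ _ (by decide)) (hf₇ _ (by decide)) (hf₇ _ (by decide))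
    refine (achieves_detect (q := q) (B := B) (g := coverStage F f (q + 1) n) (by omega) hl hlw
      (by omega) hs₇ ?_ ?_ ?_ ?_ rfl).mono (by gcongr) ?_
    · rw [hf₇ .base (by decide), hf₆ .base (by decide), g .base (by decide) (by decide), hB₄]
    · intro X hX
      rw [hf₇ .weight (by decide), hf₆ .weight (by decide), g .weight (by decide) (by decide),
        hf₄ .weight (by decide), hwt₃ X hX]
    · intro X hX
      rw [hm₇, restrict, if_pos hX]
    · rw [hf₇ .q (by decide), hf₆ .q (by decide), hq₅]
    rintro s₈ ⟨h1, h2, hf₈⟩ - -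
    have hiff : ∀ X ∈ l, coverStage F f (q + 1) n X % B ^ (X.card + 1) ≠ 0 ↔
        Partitions F (q + 1) X := fun X hX =>
      coverStage_mod_ne_zero_iff (hcard (q + 1) (by omega)) (hl X hX)
    have hout : s₇ .out 0 = s₅ .out 0 := by rw [hf₇ .out (by decide), hf₆ .out (by decide)]
    refine ⟨fun X hX => ?_, fun Y hY => ?_, ?_⟩
    · rw [State.upd_ne _ (by decide), hf₈ .power (by decide), hf₇ .power (by decide), hp₆ X hX]
    · rw [State.upd_ne _ (by decide), hf₈ .moebius (by decide), hm₇, restrict, if_neg hY]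
    · rw [State.upd_ne _ (by decide)]
      obtain ⟨b1, b2, b3, b4⟩ := hbest
      by_cases hP : ∃ X ∈ l, Partitions F (q + 1) X
      · obtain ⟨X, hX, hPX⟩ := hP
        rw [h1 ⟨X, hX, (hiff X hX).2 hPX⟩]
        exact ⟨by omega, by omega, Or.inr ⟨X, hX, hPX⟩, fun r hr hr' => by omega⟩
      · have : ∀ X ∈ l, coverStage F f (q + 1) n X % B ^ (X.card + 1) = 0 := fun X hX => by
          by_contra hne
          exact hP ⟨X, hX, (hiff X hX).1 hne⟩
        rw [h2 this, hout]
        refine ⟨b1, by omega, b3, fun r hr hr' => ?_⟩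
        by_cases e : r = q + 1
        · rw [e]; exact hP
        · exact b4 r hr (by omega)
  · rw [h.2 .n (by decide), State.upd_ne _ (by decide), hn₄]

end

end Domatic

/-! ### From set systems back to graphs, inputs and running times. -/

namespace Domatic

open Finset RAM RAM.Pr RAM.Ex

/-! ### Packings and domatic partitions -/

section packing

variable {V : Type*} {G : SimpleGraph V}

theorem _root_.IsDominating.mono {D D' : Set V} (h : IsDominating G D) (hD : D ⊆ D') :
    IsDominating G D' := fun v hv =>
  let ⟨u, hu, ha⟩ := h v fun hv' => hv (hD hv')
  ⟨u, hD hu, ha⟩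

theorem _root_.IsDominating.nonempty [Nonempty V] {D : Set V} (h : IsDominating G D) :
    D.Nonempty := by
  obtain ⟨v⟩ := ‹Nonempty V›
  by_cases hv : v ∈ D
  · exact ⟨v, hv⟩
  · obtain ⟨u, hu, -⟩ := h v hv
    exact ⟨u, hu⟩

theorem _root_.HasDominatingPacking.mono {k l : ℕ} (h : HasDominatingPacking G l) (hkl : k ≤ l) :
    HasDominatingPacking G k := by
  obtain ⟨S, h1, h2⟩ := h
  refine ⟨fun i => S (Fin.castLE hkl i), fun i => h1 _, fun i j hij => h2 _ _ fun h => hij ?_⟩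
  exact Fin.castLE_injective hkl h

theorem _root_.HasDomaticPartition.packing {k : ℕ} (h : HasDomaticPartition G k) :
    HasDominatingPacking G k :=
  let ⟨S, h1, h2, _⟩ := h
  ⟨S, h1, h2⟩

/-- Supersets of dominating sets are dominating, so all uncovered vertices can join one of the sets;
this requires that there is one. -/
theorem _root_.HasDominatingPacking.partition {k : ℕ} (hk : k ≠ 0)
    (h : HasDominatingPacking G k) : HasDomaticPartition G k := by
  obtain ⟨S, h1, h2⟩ := h
  let a : Fin k := ⟨0, Nat.pos_of_ne_zero hk⟩
  refine ⟨fun i => S i ∪ {v | i = a ∧ ∀ j, v ∉ S j}, fun i => (h1 i).mono Set.subset_union_left,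
    fun i j hij => ?_, ?_⟩
  · rw [Set.disjoint_left]
    rintro v (hv | ⟨rfl, hv⟩) (hv' | ⟨rfl, hv'⟩)
    · exact Set.disjoint_left.1 (h2 i j hij) hv hv'
    · exact hv' _ hv
    · exact hv _ hv'
    · exact hij rfl
  · rw [Set.eq_univ_iff_forall]
    intro v
    rw [Set.mem_iUnion]
    by_cases hv : ∃ j, v ∈ S j
    · obtain ⟨j, hj⟩ := hv
      exact ⟨j, Or.inl hj⟩
    · exact ⟨a, Or.inr ⟨rfl, fun j hj => hv ⟨j, hj⟩⟩⟩

theorem _root_.HasDominatingPacking.le_card [Fintype V] [Nonempty V] {k : ℕ}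
    (h : HasDominatingPacking G k) : k ≤ Fintype.card V := by
  obtain ⟨S, h1, h2⟩ := h
  choose f hf using fun i => (h1 i).nonempty
  have hinj : Function.Injective f := fun i j hij => by
    by_contra hne
    exact Set.disjoint_left.1 (h2 i j hne) (hf i) (hij ▸ hf j)
  simpa using Fintype.card_le_of_injective f hinj

theorem _root_.IsDomaticNumber.packing_iff [Nonempty V] {d : ℕ} (h : IsDomaticNumber G d)
    (k : ℕ) : HasDominatingPacking G k ↔ k ≤ d := by
  constructor
  · intro hk
    rcases Nat.eq_zero_or_pos k with rfl | hpos
    · exact Nat.zero_le d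
    · exact h.2 (hk.partition hpos.ne')
  · exact fun hk => (HasDomaticPartition.packing h.1).mono hk

/-- One class is always possible, as the whole vertex set is dominating. Dominating sets are
nonempty, so there are at most `|V|` classes and the bounded search misses nothing. -/
theorem isDomaticNumber_of_isBest [Fintype V] [Nonempty V] {P : ℕ → Prop}
    (hP : ∀ q, q ≠ 0 → (P q ↔ HasDominatingPacking G (q + 1))) {d : ℕ}
    (h : IsBest P (Fintype.card V - 1) d) : IsDomaticNumber G d := by
  obtain ⟨h1, -, h3, h4⟩ := h
  constructor
  · by_cases hd : d = 1
    · subst hd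
      exact ⟨fun _ => Set.univ, fun _ v hv => absurd (Set.mem_univ v) hv,
        fun i j hij => absurd (Subsingleton.elim i j) hij, Set.iUnion_const _⟩
    · have := (hP (d - 1) (by omega)).1 (h3.resolve_left hd)
      rw [Nat.sub_add_cancel h1] at this
      exact this.partition (by omega)
  · intro k hk
    by_contra! hlt
    have hkc := (HasDomaticPartition.packing hk).le_card
    refine h4 (k - 1) (by omega) (by omega) ((hP _ (by omega)).2 ?_)
    rw [Nat.sub_add_cancel (by omega)]
    exact HasDomaticPartition.packing hk

end packing

/-! ### Graphs as set systems -/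

section graph

variable {n : ℕ} (G : SimpleGraph (Fin n))

open Classical in
/-- The closed neighbourhood of `v`. -/
noncomputable def closedNbhd (v : ℕ) : Finset ℕ :=
  (univ.filter fun u : Fin n => (u : ℕ) = v ∨ ∃ w : Fin n, (w : ℕ) = v ∧ G.Adj w u).map
    Fin.valEmbedding

variable {G}

theorem mem_closedNbhd {v u : Fin n} : (u : ℕ) ∈ closedNbhd G v ↔ u = v ∨ G.Adj v u := by
  simp [closedNbhd, Fin.val_inj]

theorem closedNbhd_subset (v : ℕ) : closedNbhd G v ⊆ range n := by
  intro u hu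
  obtain ⟨u', -, rfl⟩ := mem_map.1 hu
  exact mem_range.2 u'.2

theorem self_mem_closedNbhd {v : ℕ} (hv : v < n) : v ∈ closedNbhd G v :=
  mem_closedNbhd (v := ⟨v, hv⟩) (u := ⟨v, hv⟩) |>.2 (Or.inl rfl)

theorem closedNbhd_symm {u v : ℕ} (hu : u < n) (hv : v < n) (h : u ∈ closedNbhd G v) :
    v ∈ closedNbhd G u := by
  have := mem_closedNbhd (G := G) (v := ⟨v, hv⟩) (u := ⟨u, hu⟩) |>.1 h
  exact mem_closedNbhd (v := ⟨u, hu⟩) (u := ⟨v, hv⟩) |>.2 (this.imp Eq.symm SimpleGraph.Adj.symm)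

theorem card_closedNbhd_le [DecidableRel G.Adj] {v : ℕ} (hv : v < n) :
    (closedNbhd G v).card ≤ G.maxDegree + 1 := by
  rw [closedNbhd, card_map]
  calc _ ≤ (insert ⟨v, hv⟩ (G.neighborFinset ⟨v, hv⟩)).card := card_le_card fun u hu => by
        simp only [mem_filter, mem_univ, true_and] at hu
        rcases hu with h | ⟨w, hw, h⟩
        · exact mem_insert.2 (Or.inl (Fin.ext h))
        · obtain rfl : w = ⟨v, hv⟩ := Fin.ext hw
          exact mem_insert.2 (Or.inr ((G.mem_neighborFinset _ _).2 h))
    _ ≤ _ := (card_insert_le _ _).trans (Nat.succ_le_succ (G.degree_le_maxDegree _))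

open Classical in
/-- A set of vertices as a set of natural numbers. -/
noncomputable def natSet (D : Set (Fin n)) : Finset ℕ :=
  (univ.filter (· ∈ D)).map Fin.valEmbedding

@[simp] theorem mem_natSet {D : Set (Fin n)} {v : Fin n} : (v : ℕ) ∈ natSet D ↔ v ∈ D := by
  simp [natSet, Fin.val_inj]

theorem natSet_subset (D : Set (Fin n)) : natSet D ⊆ range n := by
  intro u hu
  obtain ⟨u', -, rfl⟩ := mem_map.1 hu
  exact mem_range.2 u'.2

theorem isDominating_iff (D : Set (Fin n)) :
    IsDominating G D ↔ ∀ v : Fin n, ∃ u : Fin n, (u : ℕ) ∈ closedNbhd G v ∧ u ∈ D := by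
  simp only [mem_closedNbhd]
  constructor
  · intro h v
    by_cases hv : v ∈ D
    · exact ⟨v, Or.inl rfl, hv⟩
    · obtain ⟨u, hu, ha⟩ := h v hv
      exact ⟨u, Or.inr ha, hu⟩
  · intro h v hv
    obtain ⟨u, rfl | ha, hu⟩ := h v
    · exact absurd hu hv
    · exact ⟨u, hu, ha⟩

/-- At level `n` every closed neighbourhood is tested; not lying inside `S` means meeting the
complement. -/
theorem splits_iff (S : Finset ℕ) : Splits (closedNbhd G) n n S ↔
    IsDominating G {v | (v : ℕ) ∈ S} ∧ IsDominating G {v | (v : ℕ) ∉ S} := by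
  rw [isDominating_iff, isDominating_iff, ← forall_and, Fin.forall_iff]
  refine forall₂_congr fun v hv => ?_
  have e1 : (closedNbhd G v ∩ S).Nonempty ↔
      ∃ u : Fin n, (u : ℕ) ∈ closedNbhd G v ∧ (u : ℕ) ∈ S := by
    constructor
    · rintro ⟨u, hu⟩
      rw [mem_inter] at hu
      exact ⟨⟨u, mem_range.1 (closedNbhd_subset v hu.1)⟩, hu⟩
    · rintro ⟨u, hu⟩
      exact ⟨u, mem_inter.2 hu⟩
  have e2 : ¬ closedNbhd G v ⊆ S ↔
      ∃ u : Fin n, (u : ℕ) ∈ closedNbhd G v ∧ (u : ℕ) ∉ S := by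
    rw [not_subset]
    constructor
    · rintro ⟨u, hu⟩
      exact ⟨⟨u, mem_range.1 (closedNbhd_subset v hu.1)⟩, hu⟩
    · rintro ⟨u, hu⟩
      exact ⟨u, hu⟩
  rw [e1, e2]
  exact ⟨fun h => h (closedNbhd_subset v), fun h _ => h⟩

theorem partitions_iff_packing {q : ℕ} (hq : q ≠ 0) :
    (∃ X ∈ layer (closedNbhd G) n n, Partitions (layer (closedNbhd G) n n).toFinset q X) ↔
      HasDominatingPacking G (q + 1) := by
  have hnb : ∀ v < n, (closedNbhd G v).Nonempty := fun v hv => ⟨v, self_mem_closedNbhd hv⟩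
  simp only [Partitions, List.mem_toFinset, mem_layer hnb, splits_iff]
  constructor
  · rintro ⟨X, ⟨-, -, hX⟩, τ, h1, h2, h3⟩
    have hdisj : ∀ k, Disjoint {v : Fin n | (v : ℕ) ∈ τ k} {v : Fin n | (v : ℕ) ∉ X} := by
      intro k
      rw [Set.disjoint_left]
      intro v hv hv'
      exact hv' (h3 ▸ mem_biUnion.2 ⟨k, mem_univ k, hv⟩)
    -- The complement of `X` is dominating and disjoint from all the parts, so it serves as the last
    -- set.
    refine ⟨Fin.snoc (α := fun _ => Set (Fin n)) (fun k => {v | (v : ℕ) ∈ τ k})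
      {v | (v : ℕ) ∉ X}, fun i => ?_, fun i j => ?_⟩
    · refine Fin.lastCases ?_ (fun k => ?_) i
      · simpa using hX
      · simpa using (h1 k).2.1
    · refine Fin.lastCases ?_ (fun k => ?_) i <;> refine Fin.lastCases ?_ (fun k' => ?_) j
      · simp
      · intro _
        simpa using (hdisj k').symm
      · intro _
        simpa using hdisj k
      · intro hne
        simp only [Fin.snoc_castSucc]
        rw [Set.disjoint_left]
        exact fun v hv hv' => disjoint_left.1 (h2 k k' fun h => hne (h ▸ rfl)) hv hv'
  · rintro ⟨S, h1, h2⟩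
    -- The last set lies in the complement of each other set and of their union, which makes all
    -- these complements dominating. The union itself is dominating because `q ≠ 0`.
    have hcompl : ∀ k : Fin q, S (Fin.last q) ⊆ {v | (v : ℕ) ∉ natSet (S k.castSucc)} := by
      intro k v hv hv'
      exact Set.disjoint_left.1 (h2 _ _ (Fin.castSucc_lt_last k).ne) (mem_natSet.1 hv') hv
    have hdom : ∀ k : Fin q, IsDominating G {v | (v : ℕ) ∈ natSet (S k.castSucc)} := fun k =>
      (h1 k.castSucc).mono fun v hv => mem_natSet.2 hv
    refine ⟨univ.biUnion fun k : Fin q => natSet (S k.castSucc), ⟨?_, ?_, ?_⟩,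
      fun k => natSet (S k.castSucc), fun k => ⟨natSet_subset _, hdom k,
        (h1 (Fin.last q)).mono (hcompl k)⟩, fun k k' hne => ?_, rfl⟩
    · exact biUnion_subset.2 fun k _ => natSet_subset _
    · exact (hdom ⟨0, Nat.pos_of_ne_zero hq⟩).mono fun v hv =>
        mem_biUnion.2 ⟨_, mem_univ _, hv⟩
    · refine (h1 (Fin.last q)).mono fun v hv hv' => ?_
      obtain ⟨k, -, hk⟩ := mem_biUnion.1 hv'
      exact hcompl k hv hk
    · rw [disjoint_left]
      intro u hu hu'
      obtain ⟨v, rfl⟩ : ∃ v : Fin n, (v : ℕ) = u := ⟨⟨u, mem_range.1 (natSet_subset _ hu)⟩, rfl⟩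
      exact Set.disjoint_left.1 (h2 _ _ fun h => hne (Fin.castSucc_injective q h))
        (mem_natSet.1 hu) (mem_natSet.1 hu')

/-! ### The input -/

variable [DecidableRel G.Adj]

theorem length_encodeGraph : (encodeGraph G).length = n * n + 1 := by simp [encodeGraph]

theorem encodeGraphNat_zero : encodeGraphNat G 0 = encodeGraph G := by simp [encodeGraphNat]

/-- The ones start at position `n * n + 1`, and reading past the end gives `0`; one access thus
compares `d` with the unary `k`, in time independent of `k`. -/
theorem getD_encodeGraphNat_ones (k d : ℕ) :
    (encodeGraphNat G k).getD (n * n + 1 + d) 0 = if d < k then 1 else 0 := by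
  rw [encodeGraphNat, List.getD_append_right _ _ _ _ (by rw [length_encodeGraph]; omega),
    length_encodeGraph, Nat.add_sub_cancel_left]
  split_ifs with h
  · rw [List.getD_eq_getElem _ _ (by simpa using h), List.getElem_replicate]
  · rw [List.getD_eq_default _ _ (by simpa using h)]

theorem getD_encodeGraphNat_le (k i : ℕ) : (encodeGraphNat G k).getD i 0 ≤ max n 1 := by
  have : ∀ a ∈ encodeGraphNat G k, a ≤ max n 1 := by
    intro a ha
    simp only [encodeGraphNat, encodeGraph, List.cons_append, List.mem_cons, List.mem_append,
      List.mem_ofFn, List.mem_replicate] at ha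
    rcases ha with rfl | ⟨p, rfl⟩ | ⟨-, rfl⟩
    · exact le_max_left _ _
    · split_ifs <;> simp
    · exact le_max_right _ _
  by_cases hi : i < (encodeGraphNat G k).length
  · rw [List.getD_eq_getElem _ _ hi]
    exact this _ (List.getElem_mem hi)
  · rw [List.getD_eq_default _ _ (not_lt.1 hi)]
    exact Nat.zero_le _

theorem describes_encodeGraphNat (k : ℕ) : Describes (encodeGraphNat G k) n (closedNbhd G) where
  size := by simp [encodeGraphNat, encodeGraph]
  entry v hv u hu := by
    have hlt : v * n + u < n * n := by
      calc v * n + u < v * n + n := by omega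
        _ = (v + 1) * n := by ring
        _ ≤ n * n := Nat.mul_le_mul_right _ hv
    have hdiv : (⟨v * n + u, hlt⟩ : Fin (n * n)).divNat = ⟨v, hv⟩ := by
      ext
      simp only [Fin.coe_divNat]
      rw [mul_comm, Nat.mul_add_div (by omega), Nat.div_eq_of_lt hu, add_zero]
    have hmod : (⟨v * n + u, hlt⟩ : Fin (n * n)).modNat = ⟨u, hu⟩ := by
      ext
      simp only [Fin.coe_modNat]
      rw [mul_comm, Nat.mul_add_mod, Nat.mod_eq_of_lt hu]
    have hget : (encodeGraphNat G k).getD (1 + (v * n + u)) 0 =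
        if G.Adj ⟨v, hv⟩ ⟨u, hu⟩ then 1 else 0 := by
      rw [encodeGraphNat, List.getD_append _ _ _ _ (by rw [length_encodeGraph]; omega),
        List.getD_eq_getElem _ _ (by rw [length_encodeGraph]; omega)]
      simp only [encodeGraph, add_comm 1, List.getElem_cons_succ, List.getElem_ofFn, hdiv, hmod]
    have hm := mem_closedNbhd (G := G) (v := ⟨v, hv⟩) (u := ⟨u, hu⟩)
    simp only [Fin.mk.injEq] at hm
    rw [hget]
    by_cases huv : u = v
    · subst huv
      simp [hm]
    · have : 1 - (u - v + (v - u)) = 0 := by omega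
      simp [hm, huv, this]
  self _ hv := self_mem_closedNbhd hv
  sub v _ := closedNbhd_subset v

end graph

/-! ### Running time -/

/-- The bound on the bit length of the entries. -/
def wordSize (n : ℕ) : ℕ := (n + n * n * n) * n + n * n + 2 * n + 3

theorem wordSize_succ_sq_le {n : ℕ} (hn : 1 ≤ n) : (wordSize n + 1) ^ 2 ≤ 81 * n ^ 8 := by
  have : wordSize n + 1 ≤ 9 * n ^ 4 := by
    obtain ⟨a, rfl⟩ : ∃ a, n = a + 1 := ⟨n - 1, by omega⟩
    rw [wordSize]
    ring_nf
    omega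
  calc _ ≤ (9 * n ^ 4) ^ 2 := Nat.pow_le_pow_left this 2
    _ = _ := by ring

theorem exists_outputs_of_achieves {x : List ℕ} {w T : ℕ} {p : Pr} {Q : State → Prop}
    (hx : ∀ i, x.getD i 0 < 2 ^ w) (h : Achieves x w p (fun _ _ => 0) T Q) :
    ∃ t s, Outputs p.toRProg x t (s Tag.out 0) ∧ t ≤ T * (p.len ^ 2 * (w + 1) ^ 2) ∧ Q s := by
  obtain ⟨t, m, s, h1, h2, -, h4, h5⟩ := h hx (fun _ => 0) (fun _ _ => rfl) fun _ => by positivity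
  exact ⟨t, s, ⟨m, h1, by rw [← h2 .out 0]; rfl⟩, h4, h5⟩

/-- The exponent `12` is `4` from the number of steps plus `8` from the squared word size; the extra
step is the final comparison with `k`. -/
theorem time_le {t n M L Δ : ℕ} (hn : 1 ≤ n)
    (ht : t ≤ (domaticSteps n M + 1) * (L ^ 2 * (wordSize n + 1) ^ 2)) (hM1 : 1 ≤ M)
    (hM : (M : ℝ) ≤ ((2 : ℝ) ^ (Δ + 1) - 2) ^ ((n : ℝ) / ((Δ : ℝ) + 1))) :
    (t : ℝ) ≤ (301 * 81 * L ^ 2 : ℕ) * (n : ℝ) ^ 12 *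
      ((2 : ℝ) ^ (Δ + 1) - 2) ^ ((n : ℝ) / ((Δ : ℝ) + 1)) := by
  have h1 : domaticSteps n M + 1 ≤ 301 * (n ^ 4 * M) := by
    have : 1 ≤ n ^ 4 * M := Nat.mul_pos (by positivity) hM1
    rw [domaticSteps]
    omega
  have h2 : t ≤ 301 * 81 * L ^ 2 * n ^ 12 * M :=
    calc t ≤ 301 * (n ^ 4 * M) * (L ^ 2 * (81 * n ^ 8)) :=
          ht.trans (Nat.mul_le_mul h1 (Nat.mul_le_mul_left _ (wordSize_succ_sq_le hn)))
      _ = _ := by ring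
  calc (t : ℝ) ≤ ((301 * 81 * L ^ 2 * n ^ 12 * M : ℕ) : ℝ) := by exact_mod_cast h2
    _ = (301 * 81 * L ^ 2 : ℕ) * (n : ℝ) ^ 12 * M := by push_cast; ring
    _ ≤ _ := by gcongr

section

variable {n : ℕ} {G : SimpleGraph (Fin n)} [DecidableRel G.Adj]

/-- `M` is the length of a longest layer, at least `1` because of layer `0`. The counting bound
applies to every layer, in particular to this one. -/
theorem exists_layer_bound (hΔ : 1 ≤ G.maxDegree) : ∃ M : ℕ, 1 ≤ M ∧
    (∀ i ≤ n, (layer (closedNbhd G) n i).length ≤ M) ∧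
    (M : ℝ) ≤ ((2 : ℝ) ^ (G.maxDegree + 1) - 2) ^ ((n : ℝ) / ((G.maxDegree : ℝ) + 1)) := by
  have hnb : ∀ v < n, (closedNbhd G v).Nonempty := fun v hv => ⟨v, self_mem_closedNbhd hv⟩
  obtain ⟨i, hi, hmax⟩ := exists_max_image (range (n + 1))
    (fun i => (layer (closedNbhd G) n i).length) ⟨0, by simp⟩
  refine ⟨(layer (closedNbhd G) n i).length, ?_, fun j hj => hmax j (by simpa using by omega), ?_⟩
  · simpa [layer] using hmax 0 (by simp)
  · refine card_le_rpow ?_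
    rw [← List.toFinset_card_of_nodup (nodup_layer hnb i)]
    refine card_pow_le_of_splits hΔ (by simpa [Nat.lt_succ_iff] using hi)
      (fun v hv => self_mem_closedNbhd hv)
      (fun v _ => closedNbhd_subset v) (fun u hu v hv h => closedNbhd_symm hu hv h)
      (fun v hv => card_closedNbhd_le hv) _ fun S hS => (mem_layer hnb).1 (List.mem_toFinset.1 hS)

theorem pos_of_one_le_maxDegree (hΔ : 1 ≤ G.maxDegree) : 1 ≤ n := by
  rcases Nat.eq_zero_or_pos n with rfl | h
  · have := G.maxDegree_le_of_forall_degree_le 0 fun v => v.elim0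
    omega
  · exact h

theorem achieves_domatic_graph (hΔ : 1 ≤ G.maxDegree) (k : ℕ) {M : ℕ} (hM1 : 1 ≤ M)
    (hM : ∀ i ≤ n, (layer (closedNbhd G) n i).length ≤ M) :
    Achieves (encodeGraphNat G k) (wordSize n) domatic (fun _ _ => 0) (domaticSteps n M)
      (fun s => s .n 0 = n ∧ IsDomaticNumber G (s .out 0) ∧ s .out 0 ≤ n) := by
  have hn := pos_of_one_le_maxDegree hΔ
  have : Nonempty (Fin n) := ⟨⟨0, hn⟩⟩
  refine (achieves_domatic (describes_encodeGraphNat k) hn le_rfl hM1 hM).mono le_rfl fun s h =>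
    ⟨h.1, isDomaticNumber_of_isBest (fun q hq => partitions_iff_packing hq) ?_, ?_⟩
  · simpa using h.2
  · have := h.2.2.1
    omega

theorem getD_lt_two_pow (hn : 1 ≤ n) (k i : ℕ) : (encodeGraphNat G k).getD i 0 < 2 ^ wordSize n :=
  ((getD_encodeGraphNat_le k i).trans (max_le le_rfl hn)).trans_lt
    (lt_two_pow_of_le Nat.lt_two_pow_self (by rw [wordSize]; nlinarith [Nat.zero_le (n * n * n)]))

end

/-- Decide whether there is a packing with as many dominating sets as the unary number that follows
the graph indicates. -/
def packing : Pr :=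
  .seq domatic <|
  assign .out (.sub (.lit 1)
    (.inp (.add (.add (.mul (.var .n) (.var .n)) (.lit 1)) (.var .out))))

end Domatic

theorem mainTheorem4 :
    (∃ (p : RAM.RProg) (C c : ℕ), ∀ (n Δ k : ℕ) (G : SimpleGraph (Fin n)) [DecidableRel G.Adj],
      1 ≤ Δ → G.maxDegree = Δ →
      ∃ t r : ℕ, RAM.Outputs p (encodeGraphNat G k) t r ∧
        (HasDominatingPacking G k → r = 1) ∧ (¬ HasDominatingPacking G k → r = 0) ∧
        (t : ℝ) ≤ C * (n : ℝ) ^ c * ((2 : ℝ) ^ (Δ + 1) - 2) ^ ((n : ℝ) / ((Δ : ℝ) + 1))) ∧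
    (∃ (p : RAM.RProg) (C c : ℕ), ∀ (n Δ : ℕ) (G : SimpleGraph (Fin n)) [DecidableRel G.Adj],
      1 ≤ Δ → G.maxDegree = Δ →
      ∃ t d : ℕ, RAM.Outputs p (encodeGraph G) t d ∧ IsDomaticNumber G d ∧
        (t : ℝ) ≤ C * (n : ℝ) ^ c * ((2 : ℝ) ^ (Δ + 1) - 2) ^ ((n : ℝ) / ((Δ : ℝ) + 1))) := by
  open Domatic RAM in
  refine ⟨⟨packing.toRProg, 301 * 81 * packing.len ^ 2, 12, ?_⟩,
    ⟨domatic.toRProg, 301 * 81 * domatic.len ^ 2, 12, ?_⟩⟩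
  · rintro n _ k G _ hΔ rfl
    classical
    have hn := pos_of_one_le_maxDegree hΔ
    have : Nonempty (Fin n) := ⟨⟨0, hn⟩⟩
    obtain ⟨M, hM1, hM, hMΔ⟩ := exists_layer_bound hΔ
    have h : Achieves (encodeGraphNat G k) (wordSize n) packing (fun _ _ => 0)
        (domaticSteps n M + 1)
        (fun s => s .out 0 = if HasDominatingPacking G k then 1 else 0) := by
      refine .seq ((achieves_domatic_graph hΔ k hM1 hM).mono le_rfl ?_)
      rintro s ⟨hsn, hd, -⟩
      -- With `d` the domatic number, the entry read is `1` iff `d < k`, so its complement to `1`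
      -- indicates `k ≤ d`.
      have he : (Ex.sub (.lit 1) (.inp (.add (.add (.mul (.var .n) (.var .n)) (.lit 1))
          (.var .out)))).eval (encodeGraphNat G k) s =
          if HasDominatingPacking G k then 1 else 0 := by
        simp only [Ex.eval, Ex.eval_var, hsn, getD_encodeGraphNat_ones, hd.packing_iff]
        split_ifs <;> omega
      refine .assign ?_ ?_
      · rw [he]
        exact lt_of_le_of_lt (b := 1) (by split_ifs <;> simp)
          (Nat.one_lt_two_pow (by simp [wordSize]))
      · rw [he]
        simp
    obtain ⟨t, s, h1, h2, h3⟩ := exists_outputs_of_achieves (getD_lt_two_pow hn k) h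
    exact ⟨t, _, h1, fun hk => by rw [h3, if_pos hk], fun hk => by rw [h3, if_neg hk],
      time_le hn h2 hM1 hMΔ⟩
  · rintro n _ G _ hΔ rfl
    have hn := pos_of_one_le_maxDegree hΔ
    obtain ⟨M, hM1, hM, hMΔ⟩ := exists_layer_bound hΔ
    obtain ⟨t, s, h1, h2, h3⟩ := exists_outputs_of_achieves (getD_lt_two_pow hn 0)
      (achieves_domatic_graph hΔ 0 hM1 hM)
    rw [encodeGraphNat_zero] at h1
    exact ⟨t, _, h1, h3.2.1, time_le hn (h2.trans (Nat.mul_le_mul_right _ (Nat.le_succ _))) hM1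
      hMΔ⟩
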